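/- Let $n\ge 1$, let $\eta:\mathbb{R}^n\to\mathbb{R}^n$ be a $C^2$ vector field, and let $F_t(x)=F(t,x)$ be its flow map, i.e. $\partial_t F(t,x)=\eta(F(t,x))$ and $F(0,x)=x$ for all $x\in\mathbb{R}^n$ and all $t$ in an open interval $J\ni 0$. Let $M\subset\mathbb{R}^n$ be an embedded $C^2$ hypersurface, let $M_t=F_t(M)$, and for $t\in J$ let $\nu(t)$ be a unit normal field along $M_t$ such that $(t,p)\mapsto\nu(t)(F_t(p))$ is continuous on $J\times M$. The field $\eta$ need not be normal to $M_t$. Let $(x^1,\dots,x^{n-1})$ be local $C^2$ coordinates of $M$, with parametrization $X$; via $F_t\circ X$, again denoted $F_t$, they are also used as local coordinates of $M_t$. Put $g_{ij}(t)=\langle\partial_iF_t,\partial_jF_t\rangle$, let $(g^{ij})$ be the inverse matrix, let $d\sigma_t=\sqrt{\det g(t)}\,dx^1\cdots dx^{n-1}$ be the area element of $M_t$, let $h_{ij}(t)=\langle\partial_i\nu(t),\partial_jF_t\rangle$ be the second fundamental form, $H=g^{ij}h_{ij}$ the mean curvature, and $\operatorname{div}_{M_t}\eta=g^{ij}\langle(\nabla\eta)\partial_iF_t,\partial_jF_t\rangle$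 the tangential divergence. Let $\nabla_i\nabla_j f=\partial_i\partial_jf-\Gamma_{ij}^k\partial_kf$ be the components of the Hessian on $M_t$ of the restriction of $f$ to $M_t$, where $\Gamma_{ij}^k$ are the Christoffel symbols of $g(t)$ (componentwise if $f$ is vector valued), and $\Delta_{M_t}f=g^{ij}\nabla_i\nabla_jf$. Then, at every point of the coordinate patch and for every $t\in J$, the derivatives below exist and $$\frac{d}{dt}d\sigma_t=(\operatorname{div}_{M_t}\eta)\,d\sigma_t,\qquad\text{that is,}\qquad \frac{d}{dt}\sqrt{\det g(t)}=(\operatorname{div}_{M_t}\eta)\sqrt{\det g(t)},$$ $$\frac{d}{dt}\big(\eta(F_t)\cdot\nu(t)\big)=\big(\eta(F_t)\cdot\nu(t)\big)\,(\operatorname{div}\eta-\operatorname{div}_{M_t}\eta)\circ F_t,$$ $$h_{ij}'(t)=-\langle\nabla_i\nabla_j\eta,\nu(t)\rangle\qquad(1\le i,j\le n-1).$$ If moreover $M$ is a sphere of radius $R>0$ (of dimension $n-1$), then, with $\nu=\nu(0)$, $$\frac{d}{dt}\Big|_{t=0}H=-\Delta_M(\eta\cdot\nu)-\frac{n-1}{R^2}\,\eta\cdot\nu,$$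 where $H$ at time $t$ is evaluated at the point $F_t(p)$ for fixed $p\in M$. -/

import Mathlib

open scoped RealInnerProductSpace

noncomputable section

namespace GeomFlow

/-- Euclidean space `ℝⁿ`. -/
abbrev E (n : ℕ) := EuclideanSpace ℝ (Fin n)

/-- `F` is the flow map of the vector field `η` for times in `J` :
`∂F/∂t (t, x) = η (F (t, x))` and `F (0, x) = x`. -/
structure IsFlowMap {n : ℕ} (η : E n → E n) (J : Set ℝ) (F : ℝ → E n → E n) : Prop where
  zero : ∀ x, F 0 x = x
  deriv : ∀ t ∈ J, ∀ x, HasDerivAt (fun s => F s x) (η (F t x)) t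

/-- `X : U → M` is a regular `C²` local parametrization of `M ⊆ ℝᵐ⁺¹` (its inverse is a system
of local coordinates of `M`): `U ⊆ ℝᵐ` is open and `X` is a `C²` immersion on `U` which is a
homeomorphism from `U` onto a relatively open subset of `M`. -/
structure IsLocalParam {m : ℕ} (M : Set (E (m + 1))) (U : Set (E m)) (X : E m → E (m + 1)) :
    Prop where
  isOpen : IsOpen U
  contDiffOn : ContDiffOn ℝ 2 X U
  immersion : ∀ x ∈ U, Function.Injective (fderiv ℝ X x)
  isEmbedding : Topology.IsEmbedding (U.domRestrict X)
  image_eq : ∃ V : Set (E (m + 1)), IsOpen V ∧ X '' U = M ∩ V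

/-- `M` is an (embedded, `C²`) hypersurface of `ℝᵐ⁺¹`. -/
def IsHypersurface {m : ℕ} (M : Set (E (m + 1))) : Prop :=
  ∀ p ∈ M, ∃ (U : Set (E m)) (X : E m → E (m + 1)), IsLocalParam M U X ∧ p ∈ X '' U

/-- `ν` is a field of unit normal vectors along the set `S`. (For an embedded hypersurface the
tangent cone at a point is the tangent space.) -/
def IsUnitNormal {n : ℕ} (S : Set (E n)) (ν : E n → E n) : Prop :=
  ∀ q ∈ S, ‖ν q‖ = 1 ∧ ∀ v ∈ tangentConeAt ℝ S q, ⟪ν q, v⟫ = 0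

/-- Divergence of a vector field on `ℝⁿ`. -/
def divergence {n : ℕ} (η : E n → E n) (p : E n) : ℝ :=
  ∑ a, (fderiv ℝ η p (EuclideanSpace.single a 1)) a

section LocalCoordinates

/-! In this section `Y` is a local parametrization of a hypersurface, `x` is a point of its
coordinate domain, and functions on the hypersurface are written in the coordinates. -/

variable {m : ℕ} {G : Type*} [NormedAddCommGroup G] [NormedSpace ℝ G]

/-- The coordinate derivative `∂ᵢ f`. -/
def pd (i : Fin m) (f : E m → G) (x : E m) : G :=
  fderiv ℝ f x (EuclideanSpace.single i 1)

/-- The induced metric `gᵢⱼ = ⟨∂ᵢY, ∂ⱼY⟩`; its inverse matrix is `gⁱʲ`. -/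
def metric (Y : E m → E (m + 1)) (x : E m) : Matrix (Fin m) (Fin m) ℝ :=
  Matrix.of fun i j => ⟪pd i Y x, pd j Y x⟫

/-- The density `√(det g)` of the area element `dσ = √(det g) dx¹ ⋯ dxᵐ`. -/
def areaDensity (Y : E m → E (m + 1)) (x : E m) : ℝ :=
  √ (metric Y x).det

/-- The tangential divergence `gⁱʲ ⟨∂ᵢη, ∂ⱼY⟩`, where `∂ᵢη = (∇η) ∂ᵢY`. -/
def tangentialDiv (η : E (m + 1) → E (m + 1)) (Y : E m → E (m + 1)) (x : E m) : ℝ :=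
  ∑ i, ∑ j, (metric Y x)⁻¹ i j * ⟪fderiv ℝ η (Y x) (pd i Y x), pd j Y x⟫

/-- The second fundamental form `hᵢⱼ = ⟨∂ᵢN, ∂ⱼY⟩` with respect to the unit normal `N`. -/
def secondForm (Y N : E m → E (m + 1)) (i j : Fin m) (x : E m) : ℝ :=
  ⟪pd i N x, pd j Y x⟫

/-- The mean curvature `H = gⁱʲ hᵢⱼ`. -/
def meanCurvature (Y N : E m → E (m + 1)) (x : E m) : ℝ :=
  ∑ i, ∑ j, (metric Y x)⁻¹ i j * secondForm Y N i j x

/-- The Christoffel symbols `Γᵏᵢⱼ = ½ gᵏˡ (∂ᵢ gⱼₗ + ∂ⱼ gᵢₗ - ∂ₗ gᵢⱼ)` of the induced metric. -/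
def christoffel (Y : E m → E (m + 1)) (k i j : Fin m) (x : E m) : ℝ :=
  (1 / 2) * ∑ l, (metric Y x)⁻¹ k l *
    (pd i (fun y => metric Y y j l) x + pd j (fun y => metric Y y i l) x
      - pd l (fun y => metric Y y i j) x)

/-- The components `∇ᵢ∇ⱼ f = ∂ᵢ∂ⱼ f - Γᵏᵢⱼ ∂ₖ f` of the Hessian of a (real or vector valued)
function on the hypersurface; for vector valued `f` it is taken componentwise. -/
def hessian (Y : E m → E (m + 1)) (f : E m → G) (i j : Fin m) (x : E m) : G :=
  pd i (pd j f) x - ∑ k, christoffel Y k i j x • pd k f x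

/-- The Laplace-Beltrami operator `Δ f = gⁱʲ ∇ᵢ∇ⱼ f`. -/
def laplaceBeltrami (Y : E m → E (m + 1)) (f : E m → ℝ) (x : E m) : ℝ :=
  ∑ i, ∑ j, (metric Y x)⁻¹ i j * hessian Y f i j x

end LocalCoordinates

end GeomFlow

end

/-!
The proof has an analytic and a geometric half.

*Analysis.* The flow of a `C¹` vector field is differentiable in the initial point, and its spatial
derivative solves the variational equation (`flow_variational_equation`): the fundamental solution
`P` of the linearized equation exists on compact time intervals, and the error
`Φ_s y - Φ_s z - P(s)(y - z)` satisfies a linear equation with inhomogeneity `o(‖y - z‖)`. For a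
`C²` field the pair of the flow and its spatial derivative is again the flow of a `C¹` field, so
the same theorem gives second derivatives. Hence `d/dt` commutes with `∂ᵢ` and with `∂ᵢ∂ⱼ` along
`F_t ∘ X` (`hasDerivAt_fderiv_flow_comp`, `flow_comp_second_derivative`).

*Geometry.* Put `aᵢ = ∂ᵢ(F_t ∘ X)`, so that `aᵢ' = (∇η) aᵢ`. The vectors `aᵢ` and the unit normal `N`
form a frame (`frame_expansion`). The normal depends differentiably on time and on the point
because it is continuous and solves a linear system up to normalization
(`differentiableAt_unit_normal`); differentiating `⟨N, aᵢ⟩ = 0` and `|N|² = 1` gives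
`⟨N', aᵢ⟩ = -⟨N, (∇η) aᵢ⟩` and `⟨N', N⟩ = 0`. The area formula is Jacobi's formula for `det g`. For
`η · N`, the trace of `∇η` in the frame is `div_M η + ⟨(∇η) N, N⟩`. For the second fundamental form,
`hᵢⱼ = -⟨N, ∂ᵢ∂ⱼ(F_t ∘ X)⟩`, and the tangential part of `∂ᵢ∂ⱼ(F_t ∘ X)` has the Christoffel symbols as
coefficients (`christoffel_eq`).

*Spheres.* There `N = κ (X - c)` with a locally constant `κ = ±1 / R`, so `h = κ g` at time `0` and
`H' = gⁱʲ hᵢⱼ' - 2 κ div_M η` (`hasDerivAt_trace_of_umbilic`). The product rule and Gauss' formula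
give `Δ(η · N) = ⟨Δη, N⟩ + 2 κ div_M η - κ² m η · N` (`laplaceBeltrami_inner_normal`); the two
combine to the formula for `H'`.
-/

open Set Filter Topology

namespace GeomFlow

/-! ### Smooth dependence of a flow on the initial point -/

section Flow

variable {V : Type*} [NormedAddCommGroup V] [NormedSpace ℝ V]

/-- A barrier estimate on both sides of time `0`: the derivative only has to be controlled at the
times at which `f` touches the barrier, so that no a priori bound on `f` is needed. -/
theorem norm_le_exp_of_norm_deriv_lt {f f' : ℝ → V} {a b c K : ℝ} (h0 : (0 : ℝ) ∈ Ioo a b)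
    (hf : ∀ s ∈ Ioo a b, HasDerivAt f (f' s) s) (hc : ‖f 0‖ ≤ c)
    (bound : ∀ s ∈ Ioo a b, ‖f s‖ = c * Real.exp (K * |s|) →
      ‖f' s‖ < K * (c * Real.exp (K * |s|))) :
    ∀ s ∈ Ioo a b, ‖f s‖ ≤ c * Real.exp (K * |s|) := by
  have hB : ∀ x : ℝ, HasDerivAt (fun x => c * Real.exp (K * x)) (K * (c * Real.exp (K * x))) x := by
    intro x
    have h := (((hasDerivAt_id x).const_mul K).exp).const_mul c
    refine h.congr_deriv ?_
    simp only [id]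
    ring
  intro s hs
  rcases le_total 0 s with h | h
  · have hI : ∀ x ∈ Icc 0 s, x ∈ Ioo a b := fun x hx => ⟨h0.1.trans_le hx.1, hx.2.trans_lt hs.2⟩
    have := image_norm_le_of_norm_deriv_right_lt_deriv_boundary (a := 0) (b := s) (f := f)
      (f' := f') (fun x hx => (hf x (hI x hx)).continuousAt.continuousWithinAt)
      (fun x hx => (hf x (hI x (Ico_subset_Icc_self hx))).hasDerivWithinAt)
      (by simpa using hc) hB
      (fun x hx hx' => by
        have := bound x (hI x (Ico_subset_Icc_self hx))
        rw [abs_of_nonneg hx.1] at this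
        exact this hx') (right_mem_Icc.2 h)
    rwa [abs_of_nonneg h]
  · have hI : ∀ x ∈ Icc 0 (-s), -x ∈ Ioo a b := fun x hx =>
      ⟨by linarith [hs.1, hx.2], by linarith [hx.1, h0.2]⟩
    have hd : ∀ x ∈ Icc 0 (-s), HasDerivAt (fun y => f (-y)) (-f' (-x)) x := fun x hx =>
      ((hf (-x) (hI x hx)).scomp x (hasDerivAt_neg x)).congr_deriv (by simp)
    have := image_norm_le_of_norm_deriv_right_lt_deriv_boundary (a := 0) (b := -s)
      (f := fun y => f (-y)) (f' := fun x => -f' (-x))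
      (fun x hx => (hd x hx).continuousAt.continuousWithinAt)
      (fun x hx => (hd x (Ico_subset_Icc_self hx)).hasDerivWithinAt)
      (by simpa using hc) hB
      (fun x hx hx' => by
        have := bound (-x) (hI x (Ico_subset_Icc_self hx))
        rw [abs_neg, abs_of_nonneg hx.1] at this
        rw [norm_neg]
        exact this hx') (right_mem_Icc.2 (by linarith))
    rw [abs_of_nonpos h]
    simpa using this

variable [FiniteDimensional ℝ V]

/-- The linear equation `P' = A P`, `P 0 = 1`, has a solution on the whole interval on which `A` is
defined. -/
theorem exists_fundamental_solution {A : ℝ → V →L[ℝ] V} {a b : ℝ}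
    (h0 : (0 : ℝ) ∈ Ioo a b) (hA : ContinuousOn A (Icc a b)) :
    ∃ P : ℝ → V →L[ℝ] V, P 0 = ContinuousLinearMap.id ℝ V ∧
      ∀ s ∈ Ioo a b, HasDerivAt P ((A s).comp (P s)) s := by
  obtain ⟨L, hL⟩ := isCompact_Icc.exists_bound_of_continuousOn hA
  have hL0 : 0 ≤ L := (norm_nonneg _).trans (hL 0 (Ioo_subset_Icc_self h0))
  set T := max b (-a)
  -- any solution stays in the ball of radius `r`, so the equation may be cut off outside it
  set r := Real.exp ((L + 1) * T)
  have hr : 0 < r := Real.exp_pos _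
  let χ : ContDiffBump (0 : V →L[ℝ] V) := ⟨r, r + 1, hr, by linarith⟩
  let g : (V →L[ℝ] V) → (V →L[ℝ] V) := fun Q => χ Q • Q
  have hg : ContDiff ℝ 1 g := χ.contDiff.smul contDiff_id
  have hgc : HasCompactSupport g := χ.hasCompactSupport.smul_right
  obtain ⟨K, hK⟩ := hg.lipschitzWith_of_hasCompactSupport hgc one_ne_zero
  obtain ⟨C, hC⟩ := hgc.exists_bound_of_continuous hg.continuous
  have hC0 : 0 ≤ C := (norm_nonneg _).trans (hC 0)
  have hT : 0 ≤ T := h0.2.le.trans (le_max_left _ _)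
  let L' : NNReal := ⟨L, hL0⟩
  let C' : NNReal := ⟨C, hC0⟩
  let T' : NNReal := ⟨T, hT⟩
  have hp : IsPicardLindelof (fun t Q => (A t).comp (g Q)) (tmin := a) (tmax := b)
      ⟨0, Ioo_subset_Icc_self h0⟩ (ContinuousLinearMap.id ℝ V) (L' * C' * T') 0 (L' * C')
      (L' * K) := by
    constructor
    · intro t ht
      refine LipschitzOnWith.of_dist_le_mul fun Q _ Q' _ => ?_
      have h1 : (A t).comp (g Q) - (A t).comp (g Q') = (A t).comp (g Q - g Q') := by
        ext; simp
      rw [dist_eq_norm, h1]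
      refine (ContinuousLinearMap.opNorm_comp_le _ _).trans ?_
      rw [NNReal.coe_mul, mul_assoc]
      refine mul_le_mul (hL t ht) ?_ (norm_nonneg _) hL0
      rw [← dist_eq_norm]
      exact hK.dist_le_mul Q Q'
    · intro Q _
      exact hA.clm_comp continuousOn_const
    · intro t ht Q _
      exact (ContinuousLinearMap.opNorm_comp_le _ _).trans
        (mul_le_mul (hL t ht) (hC Q) (norm_nonneg _) hL0)
    · simp only [sub_zero, zero_sub, NNReal.coe_zero]
      exact le_rfl
  obtain ⟨P, hP0, hP⟩ := hp.exists_eq_forall_mem_Icc_hasDerivWithinAt₀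
  have hP' : ∀ s ∈ Ioo a b, HasDerivAt P ((A s).comp (g (P s))) s := fun s hs =>
    (hP s (Ioo_subset_Icc_self hs)).hasDerivAt (Icc_mem_nhds hs.1 hs.2)
  have hsr : ∀ s ∈ Ioo a b, 1 * Real.exp ((L + 1) * |s|) ≤ r := by
    intro s hs
    rw [one_mul]
    apply Real.exp_le_exp.2
    refine mul_le_mul_of_nonneg_left ?_ (by linarith)
    exact abs_le'.2 ⟨hs.2.le.trans (le_max_left _ _),
      (neg_le_neg hs.1.le).trans (le_max_right _ _)⟩
  have hgr : ∀ Q, ‖Q‖ ≤ r → g Q = Q := by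
    intro Q hQ
    have : χ Q = 1 := χ.one_of_mem_closedBall (by simpa [χ] using hQ)
    simp [g, this]
  have hPr : ∀ s ∈ Ioo a b, ‖P s‖ ≤ r := by
    intro s hs
    refine (norm_le_exp_of_norm_deriv_lt h0 hP' ?_ ?_ s hs).trans (hsr s hs)
    · change P 0 = _ at hP0
      rw [hP0]
      exact ContinuousLinearMap.norm_id_le
    · intro s hs h
      rw [hgr _ (h.le.trans (hsr s hs)), ← h]
      refine (ContinuousLinearMap.opNorm_comp_le _ _).trans_lt ?_
      have h1 : 0 < ‖P s‖ := by rw [h]; positivity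
      nlinarith [hL s (Ioo_subset_Icc_self hs)]
  refine ⟨P, hP0, fun s hs => ?_⟩
  have := hP' s hs
  rwa [hgr _ (hPr s hs)] at this

/-- The flow of a `C¹` vector field is differentiable in the initial point, and its derivative is
the fundamental solution of the linearized equation. -/
theorem hasFDerivAt_flow_of_fundamental_solution {ζ : V → V} (hζ : ContDiff ℝ 1 ζ)
    {Φ : ℝ → V → V} {a b : ℝ} (h0 : (0 : ℝ) ∈ Ioo a b) (hΦ0 : ∀ z, Φ 0 z = z)
    (hΦ : ∀ t ∈ Icc a b, ∀ z, HasDerivAt (fun s => Φ s z) (ζ (Φ t z)) t) (z : V)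
    {P : ℝ → V →L[ℝ] V} (hP0 : P 0 = ContinuousLinearMap.id ℝ V)
    (hP : ∀ s ∈ Ioo a b, HasDerivAt P ((fderiv ℝ ζ (Φ s z)).comp (P s)) s) :
    ∀ s ∈ Ioo a b, HasFDerivAt (Φ s) (P s) z := by
  have : ProperSpace V := FiniteDimensional.proper ℝ V
  have hdζ : ∀ y, DifferentiableAt ℝ ζ y := fun y => (hζ.differentiable one_ne_zero) y
  have hcζ : Continuous (fderiv ℝ ζ) := hζ.continuous_fderiv one_ne_zero
  have hγ : ContinuousOn (fun s => Φ s z) (Icc a b) := fun s hs =>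
    (hΦ s hs z).continuousAt.continuousWithinAt
  set κ := Metric.cthickening 1 ((fun s => Φ s z) '' Icc a b) with hκ
  have hκc : IsCompact κ := (isCompact_Icc.image_of_continuousOn hγ).cthickening
  have hmem : ∀ s ∈ Ioo a b, ∀ y ∈ Metric.closedBall (Φ s z) 1, y ∈ κ := fun s hs y hy =>
    Metric.mem_cthickening_of_dist_le y (Φ s z) 1 _
      (mem_image_of_mem _ (Ioo_subset_Icc_self hs)) hy
  obtain ⟨L, hL⟩ := hκc.exists_bound_of_continuousOn hcζ.continuousOn
  have hL0 : 0 ≤ L := (norm_nonneg _).trans (hL _ (hmem 0 h0 _ (Metric.mem_closedBall_self zero_le_one)))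
  set T := max b (-a)
  have hT : 0 ≤ T := h0.2.le.trans (le_max_left _ _)
  have hsT : ∀ s ∈ Ioo a b, |s| ≤ T := fun s hs =>
    abs_le'.2 ⟨hs.2.le.trans (le_max_left _ _), (neg_le_neg hs.1.le).trans (le_max_right _ _)⟩
  set C := Real.exp ((L + 1) * T)
  have hC : 0 < C := Real.exp_pos _
  have hsC : ∀ s ∈ Ioo a b, Real.exp ((L + 1) * |s|) ≤ C := fun s hs =>
    Real.exp_le_exp.2 (mul_le_mul_of_nonneg_left (hsT s hs) (by linarith))
  -- nearby trajectories separate at most exponentially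
  have hlip : ∀ y, ‖y - z‖ * C ≤ 1 → ∀ s ∈ Ioo a b, ‖Φ s y - Φ s z‖ ≤ ‖y - z‖ * C := by
    intro y hy s hs
    rcases eq_or_ne y z with rfl | hyz
    · simp
    have hyz' : 0 < ‖y - z‖ := norm_pos_iff.2 (sub_ne_zero.2 hyz)
    refine (norm_le_exp_of_norm_deriv_lt h0
      (fun s hs => (hΦ s (Ioo_subset_Icc_self hs) y).sub (hΦ s (Ioo_subset_Icc_self hs) z))
      (c := ‖y - z‖) (K := L + 1) ?_ ?_ s hs).trans
      (mul_le_mul_of_nonneg_left (hsC s hs) (norm_nonneg _))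
    · simp [hΦ0]
    · intro s hs h
      simp only [Pi.sub_apply] at h
      rw [← h]
      have h1 : ‖Φ s y - Φ s z‖ ≤ 1 := by
        rw [h]
        exact (mul_le_mul_of_nonneg_left (hsC s hs) (norm_nonneg _)).trans hy
      have h2 : 0 < ‖Φ s y - Φ s z‖ := by rw [h]; positivity
      have h3 := (convex_closedBall (Φ s z) 1).norm_image_sub_le_of_norm_fderiv_le (𝕜 := ℝ)
        (fun u _ => hdζ u) (fun u hu => hL u (hmem s hs u hu))
        (Metric.mem_closedBall_self zero_le_one) (y := Φ s y) (by simpa [dist_eq_norm] using h1)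
      nlinarith
  intro s hs
  set D := Real.exp ((L + 2) * T)
  have hD : 0 < D := Real.exp_pos _
  rw [hasFDerivAt_iff_isLittleO, Asymptotics.isLittleO_iff]
  intro ε hε
  set ε' := ε / (C * D)
  have hε' : 0 < ε' := by positivity
  obtain ⟨δ, hδ, hunif⟩ := Metric.uniformContinuousOn_iff.1
    (hκc.uniformContinuousOn_of_continuous hcζ.continuousOn) ε' hε'
  set ρ := min 1 (δ / 2)
  have hρ : 0 < ρ := by positivity
  have hev : ∀ᶠ y in 𝓝 z, ‖y - z‖ * C ≤ ρ := by
    have : Tendsto (fun y => ‖y - z‖ * C) (𝓝 z) (𝓝 (‖z - z‖ * C)) := by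
      apply Continuous.tendsto; fun_prop
    simp only [sub_self, norm_zero, zero_mul] at this
    exact (this.eventually (gt_mem_nhds hρ)).mono fun _ h => h.le
  filter_upwards [hev] with y hy
  rcases eq_or_ne y z with rfl | hyz
  · simp
  have hyz' : 0 < ‖y - z‖ := norm_pos_iff.2 (sub_ne_zero.2 hyz)
  have hy1 : ‖y - z‖ * C ≤ 1 := hy.trans (min_le_left _ _)
  -- the error of the linear approximation satisfies a linear equation with small inhomogeneity
  have hd : ∀ s ∈ Ioo a b, HasDerivAt (fun s => Φ s y - Φ s z - P s (y - z))
      (ζ (Φ s y) - ζ (Φ s z) - (fderiv ℝ ζ (Φ s z)).comp (P s) (y - z)) s := fun s hs =>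
    ((hΦ s (Ioo_subset_Icc_self hs) y).sub (hΦ s (Ioo_subset_Icc_self hs) z)).sub
      ((hP s hs).clm_apply (hasDerivAt_const _ _) |>.congr_deriv (by simp))
  have hc : 0 < ε' * (‖y - z‖ * C) := by positivity
  have key := norm_le_exp_of_norm_deriv_lt h0 hd (c := ε' * (‖y - z‖ * C)) (K := L + 2)
    (by simp [hΦ0, hP0, hc.le]) ?_ s hs
  · refine key.trans ?_
    have h1 : Real.exp ((L + 2) * |s|) ≤ D :=
      Real.exp_le_exp.2 (mul_le_mul_of_nonneg_left (hsT s hs) (by linarith))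
    refine (mul_le_mul_of_nonneg_left h1 hc.le).trans (le_of_eq ?_)
    simp only [ε']
    field_simp
  · intro s hs h
    rw [← h]
    have hge : ε' * (‖y - z‖ * C) ≤ ‖Φ s y - Φ s z - P s (y - z)‖ := by
      rw [h]
      refine le_mul_of_one_le_right hc.le (Real.one_le_exp (by positivity))
    have h1 := hlip y hy1 s hs
    have h2 := (convex_closedBall (Φ s z) ρ).norm_image_sub_le_of_norm_fderiv_le' (𝕜 := ℝ)
      (f := ζ) (φ := fderiv ℝ ζ (Φ s z)) (C := ε')
      (fun u _ => hdζ u) (fun u hu => by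
        rw [← dist_eq_norm]
        have hu1 : dist u (Φ s z) ≤ ρ := hu
        refine (hunif _ (hmem s hs _ (hu1.trans (min_le_left _ _))) _
          (hmem s hs _ (Metric.mem_closedBall_self zero_le_one)) ?_).le
        have : ρ ≤ δ / 2 := min_le_right _ _
        linarith)
      (Metric.mem_closedBall_self hρ.le) (y := Φ s y)
      (by rw [Metric.mem_closedBall, dist_eq_norm]; exact h1.trans hy)
    have h3 : ζ (Φ s y) - ζ (Φ s z) - (fderiv ℝ ζ (Φ s z)).comp (P s) (y - z)
        = (ζ (Φ s y) - ζ (Φ s z) - fderiv ℝ ζ (Φ s z) (Φ s y - Φ s z))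
          + fderiv ℝ ζ (Φ s z) (Φ s y - Φ s z - P s (y - z)) := by
      simp only [ContinuousLinearMap.comp_apply, map_sub]
      abel
    rw [h3]
    refine (norm_add_le _ _).trans_lt ?_
    have h4 := (fderiv ℝ ζ (Φ s z)).le_of_opNorm_le
      (hL _ (hmem s hs _ (Metric.mem_closedBall_self zero_le_one))) (Φ s y - Φ s z - P s (y - z))
    have h5 : ε' * ‖Φ s y - Φ s z‖ ≤ ε' * (‖y - z‖ * C) := mul_le_mul_of_nonneg_left h1 hε'.le
    have h6 : 0 < ‖Φ s y - Φ s z - P s (y - z)‖ := hc.trans_le hge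
    linarith

/-- An open interval containing `0` and `t` contains a compact interval that has both points in its
interior. -/
theorem exists_Icc_subset_of_ordConnected {J : Set ℝ} (hJ : IsOpen J) (hJ' : J.OrdConnected)
    (h0 : (0 : ℝ) ∈ J) {t : ℝ} (ht : t ∈ J) :
    ∃ a b : ℝ, (0 : ℝ) ∈ Ioo a b ∧ t ∈ Ioo a b ∧ Icc a b ⊆ J := by
  have hlo : min 0 t ∈ J := by rcases min_choice 0 t with h | h <;> rwa [h]
  have hhi : max 0 t ∈ J := by rcases max_choice 0 t with h | h <;> rwa [h]
  obtain ⟨ε, hε, hε'⟩ := Metric.isOpen_iff.1 hJ _ hlo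
  obtain ⟨δ, hδ, hδ'⟩ := Metric.isOpen_iff.1 hJ _ hhi
  have h1 : min 0 t - ε / 2 ∈ J := hε' (by
    rw [Metric.mem_ball, Real.dist_eq, abs_of_neg (by linarith)]; linarith)
  have h2 : max 0 t + δ / 2 ∈ J := hδ' (by
    rw [Metric.mem_ball, Real.dist_eq, abs_of_pos (by linarith)]; linarith)
  refine ⟨_, _, ⟨?_, ?_⟩, ⟨?_, ?_⟩, hJ'.out h1 h2⟩
  · linarith [min_le_left 0 t]
  · linarith [le_max_left 0 t]
  · linarith [min_le_right 0 t]
  · linarith [le_max_right 0 t]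

variable {ζ : V → V} {J : Set ℝ} {Φ : ℝ → V → V}

/-- The flow of a `C¹` vector field is differentiable in the initial point, and its derivative
solves the variational equation. -/
theorem flow_variational_equation (hζ : ContDiff ℝ 1 ζ) (hJ : IsOpen J) (hJ' : J.OrdConnected)
    (h0 : (0 : ℝ) ∈ J) (hΦ0 : ∀ z, Φ 0 z = z)
    (hΦ : ∀ t ∈ J, ∀ z, HasDerivAt (fun s => Φ s z) (ζ (Φ t z)) t) {t : ℝ} (ht : t ∈ J) (z : V) :
    DifferentiableAt ℝ (Φ t) z ∧ HasDerivAt (fun s => fderiv ℝ (Φ s) z)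
      ((fderiv ℝ ζ (Φ t z)).comp (fderiv ℝ (Φ t) z)) t := by
  obtain ⟨a, b, h0ab, htab, hab⟩ := exists_Icc_subset_of_ordConnected hJ hJ' h0 ht
  have hA : ContinuousOn (fun s => fderiv ℝ ζ (Φ s z)) (Icc a b) :=
    (hζ.continuous_fderiv one_ne_zero).comp_continuousOn fun s hs =>
      (hΦ s (hab hs) z).continuousAt.continuousWithinAt
  obtain ⟨P, hP0, hP⟩ := exists_fundamental_solution h0ab hA
  have hd := hasFDerivAt_flow_of_fundamental_solution hζ h0ab hΦ0 (fun t ht => hΦ t (hab ht)) z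
    hP0 hP
  refine ⟨(hd t htab).differentiableAt, ?_⟩
  rw [(hd t htab).fderiv]
  refine (hP t htab).congr_of_eventuallyEq ?_
  filter_upwards [isOpen_Ioo.mem_nhds htab] with s hs
  exact (hd s hs).fderiv

/-- The spatial derivative of a flow is injective: solutions of the variational equation that vanish
at time `t` vanish at time `0`. -/
theorem fderiv_flow_injective (hζ : ContDiff ℝ 1 ζ) (hJ : IsOpen J) (hJ' : J.OrdConnected)
    (h0 : (0 : ℝ) ∈ J) (hΦ0 : ∀ z, Φ 0 z = z)
    (hΦ : ∀ t ∈ J, ∀ z, HasDerivAt (fun s => Φ s z) (ζ (Φ t z)) t) {t : ℝ} (ht : t ∈ J) (z : V) :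
    Function.Injective (fderiv ℝ (Φ t) z) := by
  rw [injective_iff_map_eq_zero]
  intro w hw
  have hI : ∀ s ∈ Icc (0 : ℝ) 1, t * (1 - s) ∈ J := fun s hs => by
    have := hJ'.convex h0 ht hs.1 (sub_nonneg.2 hs.2) (by ring)
    simpa [mul_comm] using this
  have hd : ∀ s ∈ Icc (0 : ℝ) 1, HasDerivAt (fun s => fderiv ℝ (Φ (t * (1 - s))) z w)
      (-t • fderiv ℝ ζ (Φ (t * (1 - s)) z) (fderiv ℝ (Φ (t * (1 - s))) z w)) s := by
    intro s hs
    have h1 := (flow_variational_equation hζ hJ hJ' h0 hΦ0 hΦ (hI s hs) z).2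
    have h2 : HasDerivAt (fun s : ℝ => t * (1 - s)) (-t) s := by
      simpa using ((hasDerivAt_id s).const_sub 1).const_mul t
    have h3 := (HasDerivAt.scomp (h := fun s : ℝ => t * (1 - s))
      (g₁ := fun s => fderiv ℝ (Φ s) z) s h1 h2).clm_apply (hasDerivAt_const s w)
    refine h3.congr_deriv ?_
    rw [map_zero, add_zero]
    rfl
  have hc : ContinuousOn (fun s => fderiv ℝ ζ (Φ (t * (1 - s)) z)) (Icc 0 1) := by
    refine (hζ.continuous_fderiv one_ne_zero).comp_continuousOn fun s hs => ?_
    have h2 : ContinuousAt (fun s : ℝ => t * (1 - s)) s := by fun_prop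
    exact (ContinuousAt.comp (f := fun s : ℝ => t * (1 - s)) (g := fun s => Φ s z)
      (hΦ _ (hI s hs) z).continuousAt h2).continuousWithinAt
  obtain ⟨L, hL⟩ := isCompact_Icc.exists_bound_of_continuousOn hc
  have := eq_zero_of_abs_deriv_le_mul_abs_self_of_eq_zero_right (K := |t| * L) (a := 0) (b := 1)
    (fun s hs => (hd s hs).continuousAt.continuousWithinAt)
    (fun s hs => (hd s (Ico_subset_Icc_self hs)).hasDerivWithinAt) (by simpa using hw)
    (fun s hs => by
      rw [norm_smul, norm_neg, Real.norm_eq_abs, mul_assoc]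
      exact mul_le_mul_of_nonneg_left ((fderiv ℝ ζ (Φ (t * (1 - s)) z)).le_of_opNorm_le
        (hL s (Ico_subset_Icc_self hs)) _) (abs_nonneg t))
    1 (right_mem_Icc.2 zero_le_one)
  have hid : Φ 0 = id := funext hΦ0
  simpa [hid] using this

/-- The flow of `ζ` and its spatial derivative together form the flow of the vector field
`(z, v) ↦ (ζ z, Dζ(z) v)`, which is `C¹` if `ζ` is `C²`. -/
theorem hasDerivAt_tangent_flow (hζ : ContDiff ℝ 1 ζ) (hJ : IsOpen J) (hJ' : J.OrdConnected)
    (h0 : (0 : ℝ) ∈ J) (hΦ0 : ∀ z, Φ 0 z = z)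
    (hΦ : ∀ t ∈ J, ∀ z, HasDerivAt (fun s => Φ s z) (ζ (Φ t z)) t) :
    ∀ t ∈ J, ∀ z : V × V, HasDerivAt (fun s => (Φ s z.1, fderiv ℝ (Φ s) z.1 z.2))
      (ζ (Φ t z.1), fderiv ℝ ζ (Φ t z.1) (fderiv ℝ (Φ t) z.1 z.2)) t := by
  intro t ht z
  have h1 := (flow_variational_equation hζ hJ hJ' h0 hΦ0 hΦ ht z.1).2
  refine (hΦ t ht z.1).prodMk ?_
  simpa using h1.clm_apply (hasDerivAt_const t z.2)

end Flow

/-! ### Time derivatives of the first and second derivatives of a transported map -/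

section FlowOfMap

variable {V W : Type*} [NormedAddCommGroup V] [NormedSpace ℝ V] [FiniteDimensional ℝ V]
  [NormedAddCommGroup W] [NormedSpace ℝ W] {ζ : V → V} {J : Set ℝ} {Φ : ℝ → V → V}

theorem differentiableAt_flow_comp (hζ : ContDiff ℝ 1 ζ) (hJ : IsOpen J) (hJ' : J.OrdConnected)
    (h0 : (0 : ℝ) ∈ J) (hΦ0 : ∀ z, Φ 0 z = z)
    (hΦ : ∀ t ∈ J, ∀ z, HasDerivAt (fun s => Φ s z) (ζ (Φ t z)) t) {t : ℝ} (ht : t ∈ J)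
    {Y : W → V} {x : W} (hY : DifferentiableAt ℝ Y x) : DifferentiableAt ℝ (Φ t ∘ Y) x :=
  (flow_variational_equation hζ hJ hJ' h0 hΦ0 hΦ ht (Y x)).1.comp x hY

theorem fderiv_flow_comp (hζ : ContDiff ℝ 1 ζ) (hJ : IsOpen J) (hJ' : J.OrdConnected)
    (h0 : (0 : ℝ) ∈ J) (hΦ0 : ∀ z, Φ 0 z = z)
    (hΦ : ∀ t ∈ J, ∀ z, HasDerivAt (fun s => Φ s z) (ζ (Φ t z)) t) {t : ℝ} (ht : t ∈ J)
    {Y : W → V} {x : W} (hY : DifferentiableAt ℝ Y x) (w : W) :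
    fderiv ℝ (Φ t ∘ Y) x w = fderiv ℝ (Φ t) (Y x) (fderiv ℝ Y x w) := by
  rw [fderiv_comp x (flow_variational_equation hζ hJ hJ' h0 hΦ0 hΦ ht (Y x)).1 hY]
  rfl

omit [FiniteDimensional ℝ V] in
theorem fderiv_field_comp {f : W → V} {x : W} (hζ : ContDiff ℝ 1 ζ) (hf : DifferentiableAt ℝ f x)
    (w : W) : fderiv ℝ (ζ ∘ f) x w = fderiv ℝ ζ (f x) (fderiv ℝ f x w) := by
  rw [fderiv_comp x (hζ.differentiable one_ne_zero _) hf]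
  rfl

/-- Time and space derivatives of a transported map commute. -/
theorem hasDerivAt_fderiv_flow_comp (hζ : ContDiff ℝ 1 ζ) (hJ : IsOpen J) (hJ' : J.OrdConnected)
    (h0 : (0 : ℝ) ∈ J) (hΦ0 : ∀ z, Φ 0 z = z)
    (hΦ : ∀ t ∈ J, ∀ z, HasDerivAt (fun s => Φ s z) (ζ (Φ t z)) t) {t : ℝ} (ht : t ∈ J)
    {Y : W → V} {x : W} (hY : DifferentiableAt ℝ Y x) (w : W) :
    HasDerivAt (fun s => fderiv ℝ (Φ s ∘ Y) x w) (fderiv ℝ (ζ ∘ Φ t ∘ Y) x w) t := by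
  have h1 := (flow_variational_equation hζ hJ hJ' h0 hΦ0 hΦ ht (Y x)).2
  have h2 := h1.clm_apply (hasDerivAt_const t (fderiv ℝ Y x w))
  have h3 := h2.congr_of_eventuallyEq (f₁ := fun s => fderiv ℝ (Φ s ∘ Y) x w) (by
    filter_upwards [hJ.mem_nhds ht] with s hs
    exact fderiv_flow_comp hζ hJ hJ' h0 hΦ0 hΦ hs hY w)
  refine h3.congr_deriv ?_
  rw [map_zero, add_zero,
    fderiv_field_comp hζ (differentiableAt_flow_comp hζ hJ hJ' h0 hΦ0 hΦ ht hY) w,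
    fderiv_flow_comp hζ hJ hJ' h0 hΦ0 hΦ ht hY]
  rfl

/-- Along a `C²` map `Y`, the flow of a `C²` field is twice differentiable, and time derivatives
commute with second space derivatives. This is `hasDerivAt_fderiv_flow_comp` for the tangent
flow along `y ↦ (Y y, DY(y) v)`. -/
theorem flow_comp_second_derivative (hζ : ContDiff ℝ 2 ζ) (hJ : IsOpen J) (hJ' : J.OrdConnected)
    (h0 : (0 : ℝ) ∈ J) (hΦ0 : ∀ z, Φ 0 z = z)
    (hΦ : ∀ t ∈ J, ∀ z, HasDerivAt (fun s => Φ s z) (ζ (Φ t z)) t) {t : ℝ} (ht : t ∈ J)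
    {Y : W → V} {x : W} (hY : ContDiffAt ℝ 2 Y x) (v w : W) :
    DifferentiableAt ℝ (fun y => fderiv ℝ (Φ t ∘ Y) y v) x ∧
    HasDerivAt (fun s => fderiv ℝ (fun y => fderiv ℝ (Φ s ∘ Y) y v) x w)
      (fderiv ℝ (fun y => fderiv ℝ (ζ ∘ Φ t ∘ Y) y v) x w) t := by
  have hζ1 : ContDiff ℝ 1 ζ := hζ.of_le one_le_two
  have hTζ : ContDiff ℝ 1 (fun z : V × V => (ζ z.1, fderiv ℝ ζ z.1 z.2)) := by
    have h1 : ContDiff ℝ 1 (fderiv ℝ ζ) := hζ.fderiv_right (by norm_num)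
    exact (hζ1.comp contDiff_fst).prodMk ((h1.comp contDiff_fst).clm_apply contDiff_snd)
  have hT := hasDerivAt_tangent_flow hζ1 hJ hJ' h0 hΦ0 hΦ
  have hT0 : ∀ z : V × V, (Φ 0 z.1, fderiv ℝ (Φ 0) z.1 z.2) = z := by
    have hid : Φ 0 = id := funext hΦ0
    simp [hid]
  have hYd : ∀ᶠ y in 𝓝 x, DifferentiableAt ℝ Y y :=
    (hY.eventually (by simp)).mono fun y hy => hy.differentiableAt two_ne_zero
  have hYx : DifferentiableAt ℝ Y x := hY.differentiableAt two_ne_zero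
  have hY1 : DifferentiableAt ℝ (fun y => (Y y, fderiv ℝ Y y v)) x :=
    hYx.prodMk (((hY.fderiv_right (m := 1) (by norm_num)).differentiableAt one_ne_zero).clm_apply
      (differentiableAt_const v))
  have hd : ∀ s ∈ J, DifferentiableAt ℝ
      ((fun z : V × V => (Φ s z.1, fderiv ℝ (Φ s) z.1 z.2)) ∘ fun y => (Y y, fderiv ℝ Y y v)) x :=
    fun s hs => differentiableAt_flow_comp hTζ hJ hJ' h0 hT0 hT hs hY1
  have heq : ∀ s ∈ J, (fun y => fderiv ℝ (Φ s ∘ Y) y v) =ᶠ[𝓝 x] fun y =>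
      (((fun z : V × V => (Φ s z.1, fderiv ℝ (Φ s) z.1 z.2)) ∘
        fun y => (Y y, fderiv ℝ Y y v)) y).2 := by
    intro s hs
    filter_upwards [hYd] with y hy
    exact fderiv_flow_comp hζ1 hJ hJ' h0 hΦ0 hΦ hs hy v
  refine ⟨(hd t ht).snd.congr_of_eventuallyEq (heq t ht), ?_⟩
  have key := (ContinuousLinearMap.snd ℝ V V).hasFDerivAt.comp_hasDerivAt t
    (hasDerivAt_fderiv_flow_comp hTζ hJ hJ' h0 hT0 hT ht hY1 w)
  refine (key.congr_of_eventuallyEq ?_).congr_deriv ?_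
  · filter_upwards [hJ.mem_nhds ht] with s hs
    rw [(heq s hs).fderiv_eq, fderiv.snd (hd s hs)]
    rfl
  · have h1 : (fun y => fderiv ℝ (ζ ∘ Φ t ∘ Y) y v) =ᶠ[𝓝 x] fun y =>
        (((fun z : V × V => (ζ z.1, fderiv ℝ ζ z.1 z.2)) ∘
          (fun z : V × V => (Φ t z.1, fderiv ℝ (Φ t) z.1 z.2)) ∘
          fun y => (Y y, fderiv ℝ Y y v)) y).2 := by
      filter_upwards [hYd] with y hy
      rw [fderiv_field_comp hζ1 (differentiableAt_flow_comp hζ1 hJ hJ' h0 hΦ0 hΦ ht hy) v,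
        fderiv_flow_comp hζ1 hJ hJ' h0 hΦ0 hΦ ht hy]
      rfl
    rw [h1.fderiv_eq, fderiv.snd]
    · rfl
    · exact (hTζ.differentiable one_ne_zero _).comp x (hd t ht)

end FlowOfMap

/-! ### Frames of a hyperplane and its unit normal -/

section Frame

variable {m : ℕ} {a : Fin m → E (m + 1)} {N : E (m + 1)}

theorem eq_zero_of_inner_frame_eq_zero (ha : LinearIndependent ℝ a) (hN : ‖N‖ = 1)
    (hNa : ∀ i, ⟪N, a i⟫ = 0) {d : E (m + 1)} (hda : ∀ i, ⟪a i, d⟫ = 0) (hdN : ⟪N, d⟫ = 0) :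
    d = 0 := by
  have hli : LinearIndependent ℝ (Fin.cons N a : Fin (m + 1) → E (m + 1)) := by
    rw [linearIndependent_finCons]
    refine ⟨ha, fun h => ?_⟩
    have : ∀ y ∈ Submodule.span ℝ (range a), ⟪N, y⟫ = 0 := by
      intro y hy
      induction hy using Submodule.span_induction with
      | mem y hy => obtain ⟨i, rfl⟩ := hy; exact hNa i
      | zero => exact inner_zero_right _
      | add y z _ _ h1 h2 => rw [inner_add_right, h1, h2, add_zero]
      | smul c y _ h1 => rw [inner_smul_right, h1, mul_zero]
    have h1 := this N h
    rw [real_inner_self_eq_norm_sq, hN] at h1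
    norm_num at h1
  have htop := hli.span_eq_top_of_card_eq_finrank' (by simp)
  have hall : ∀ y ∈ Submodule.span ℝ (range (Fin.cons N a : Fin (m + 1) → E (m + 1))),
      ⟪y, d⟫ = 0 := by
    intro y hy
    induction hy using Submodule.span_induction with
    | mem y hy =>
      obtain ⟨i, rfl⟩ := hy
      refine Fin.cases ?_ (fun i => ?_) i
      · simpa using hdN
      · simpa using hda i
    | zero => exact inner_zero_left _
    | add y z _ _ h1 h2 => rw [inner_add_left, h1, h2, add_zero]
    | smul c y _ h1 => rw [real_inner_smul_left, h1, mul_zero]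
  exact inner_self_eq_zero.1 (hall d (htop ▸ Submodule.mem_top))

theorem isUnit_det_gram (ha : LinearIndependent ℝ a) : IsUnit (Matrix.gram ℝ a).det :=
  isUnit_iff_ne_zero.2 (Matrix.posDef_gram_of_linearIndependent ha).det_pos.ne'

theorem gram_inv_symm (i j : Fin m) : (Matrix.gram ℝ a)⁻¹ i j = (Matrix.gram ℝ a)⁻¹ j i := by
  have h : (Matrix.gram ℝ a)⁻¹.IsHermitian := (Matrix.isHermitian_gram ℝ a).inv
  simpa using (h.apply i j).symm

/-- Expansion of a vector in the frame `a₁, …, aₘ, N`. -/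
theorem frame_expansion (ha : LinearIndependent ℝ a) (hN : ‖N‖ = 1)
    (hNa : ∀ i, ⟪N, a i⟫ = 0) (v : E (m + 1)) :
    v = ∑ i, (∑ j, (Matrix.gram ℝ a)⁻¹ i j * ⟪a j, v⟫) • a i + ⟪N, v⟫ • N := by
  have haN : ∀ i, ⟪a i, N⟫ = 0 := fun i => by rw [real_inner_comm, hNa]
  rw [← sub_eq_zero]
  refine eq_zero_of_inner_frame_eq_zero ha hN hNa (fun k => ?_) ?_
  · simp only [inner_sub_right, inner_add_right, inner_sum, inner_smul_right, haN, mul_zero,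
      add_zero]
    have h := congrFun (Matrix.mulVec_mulVec (fun j => ⟪a j, v⟫) (Matrix.gram ℝ a)
      (Matrix.gram ℝ a)⁻¹) k
    rw [Matrix.mul_nonsing_inv _ (isUnit_det_gram ha), Matrix.one_mulVec] at h
    rw [← h, sub_eq_zero]
    simp only [Matrix.mulVec, dotProduct, Matrix.gram_apply]
    exact Finset.sum_congr rfl fun i _ => mul_comm _ _
  · simp [inner_sub_right, inner_add_right, inner_sum, inner_smul_right, hNa, hN]

/-- The trace of an endomorphism computed in the frame `a₁, …, aₘ, N`. -/
theorem trace_eq_frame (ha : LinearIndependent ℝ a) (hN : ‖N‖ = 1)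
    (hNa : ∀ i, ⟪N, a i⟫ = 0) (A : E (m + 1) →L[ℝ] E (m + 1)) :
    ∑ k, (A (EuclideanSpace.single k 1)) k
      = ∑ i, ∑ j, (Matrix.gram ℝ a)⁻¹ i j * ⟪A (a i), a j⟫ + ⟪A N, N⟫ := by
  have hinner : ∀ (v w : E (m + 1)), ∑ k, v k * w k = ⟪w, v⟫ := by
    intro v w
    simp [PiLp.inner_apply]
  have h1 : ∀ k, (A (EuclideanSpace.single k 1)) k
      = ∑ i, ∑ j, (Matrix.gram ℝ a)⁻¹ i j * (a j k * A (a i) k) + N k * A N k := by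
    intro k
    conv_lhs => rw [frame_expansion ha hN hNa (EuclideanSpace.single k 1)]
    simp only [map_add, map_sum, map_smul, PiLp.add_apply, PiLp.smul_apply, smul_eq_mul,
      EuclideanSpace.inner_single_right, WithLp.ofLp_sum, Finset.sum_apply, Finset.sum_mul]
    simp [mul_assoc]
  simp_rw [h1, Finset.sum_add_distrib, hinner]
  congr 1
  rw [Finset.sum_comm]
  refine Finset.sum_congr rfl fun i _ => ?_
  rw [Finset.sum_comm]
  refine Finset.sum_congr rfl fun j _ => ?_
  rw [← Finset.mul_sum, hinner]

/-- A continuous unit normal to a differentiable family of frames is differentiable: up to a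
positive factor it solves a linear system whose coefficients are differentiable. -/
theorem differentiableAt_unit_normal {S : Type*} [NormedAddCommGroup S] [NormedSpace ℝ S]
    {a : Fin m → S → E (m + 1)} {N : S → E (m + 1)} {s₀ : S}
    (hli : LinearIndependent ℝ fun i => a i s₀) (ha : ∀ i, DifferentiableAt ℝ (a i) s₀)
    (hNc : ContinuousAt N s₀) (hN : ∀ᶠ s in 𝓝 s₀, ‖N s‖ = 1 ∧ ∀ i, ⟪N s, a i s⟫ = 0) :
    DifferentiableAt ℝ N s₀ := by
  obtain ⟨hN1, hNa⟩ := hN.self_of_nhds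
  let T : S → E (m + 1) →L[ℝ] E (m + 1) := fun s =>
    ∑ i, (innerSL ℝ (a i s)).smulRight (a i s₀) + (innerSL ℝ (N s₀)).smulRight (N s₀)
  have hTapp : ∀ s v, T s v = ∑ i, ⟪a i s, v⟫ • a i s₀ + ⟪N s₀, v⟫ • N s₀ := by
    intro s v
    simp [T, sum_apply]
  have hTd : DifferentiableAt ℝ T s₀ := by
    refine DifferentiableAt.add_const _ (DifferentiableAt.fun_sum fun i _ => ?_)
    have : (fun s => (innerSL ℝ (a i s)).smulRight (a i s₀)) = fun s =>
        ((ContinuousLinearMap.smulRightL ℝ (E (m + 1)) (E (m + 1))).flip (a i s₀))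
          (innerSL ℝ (a i s)) := by
      ext; rfl
    rw [this]
    exact (ContinuousLinearMap.differentiableAt _).comp s₀
      ((innerSL ℝ).differentiableAt.comp s₀ (ha i))
  have hinj : Function.Injective (T s₀) := by
    rw [injective_iff_map_eq_zero]
    intro v hv
    have h1 : ⟪T s₀ v, v⟫ = 0 := by rw [hv, inner_zero_left]
    rw [hTapp, inner_add_left, sum_inner] at h1
    simp only [real_inner_smul_left] at h1
    have h2 : 0 ≤ ∑ i, ⟪a i s₀, v⟫ * ⟪a i s₀, v⟫ :=
      Finset.sum_nonneg fun i _ => mul_self_nonneg _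
    have h3 := mul_self_nonneg ⟪N s₀, v⟫
    have h4 : ∑ i, ⟪a i s₀, v⟫ * ⟪a i s₀, v⟫ = 0 := by linarith
    rw [Finset.sum_eq_zero_iff_of_nonneg fun i _ => mul_self_nonneg _] at h4
    exact eq_zero_of_inner_frame_eq_zero hli hN1 hNa
      (fun i => mul_self_eq_zero.1 (h4 i (Finset.mem_univ i)))
      (mul_self_eq_zero.1 (by linarith))
  have hunit : IsUnit (T s₀) := by
    rw [ContinuousLinearMap.isUnit_iff_bijective]
    exact ⟨hinj, LinearMap.injective_iff_surjective.1 hinj⟩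
  let Z : S → E (m + 1) := fun s => Ring.inverse (T s) (N s₀)
  have hZ : DifferentiableAt ℝ Z s₀ :=
    (DifferentiableAt.inverse hTd hunit).clm_apply (differentiableAt_const _)
  have hNZ : ∀ s, IsUnit (T s) → (∀ i, ⟪N s, a i s⟫ = 0) → N s = ⟪N s₀, N s⟫ • Z s := by
    intro s hs hns
    have h1 : T s (N s) = ⟪N s₀, N s⟫ • N s₀ := by
      rw [hTapp, Finset.sum_eq_zero, zero_add]
      intro i _
      rw [real_inner_comm, hns, zero_smul]
    have h2 : Ring.inverse (T s) (T s (N s)) = N s := by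
      have := Ring.inverse_mul_cancel (T s) hs
      exact DFunLike.congr_fun this (N s)
    rw [h1, map_smul] at h2
    exact h2.symm
  have hZ0 : Z s₀ ≠ 0 := by
    intro h
    have := hNZ s₀ hunit hNa
    rw [h, smul_zero] at this
    rw [this, norm_zero] at hN1
    exact zero_ne_one hN1
  have hpos : ∀ᶠ s in 𝓝 s₀, 0 < ⟪N s₀, N s⟫ := by
    have h1 : ContinuousAt (fun s => ⟪N s₀, N s⟫) s₀ := continuousAt_const.inner hNc
    refine h1.eventually (lt_mem_nhds ?_)
    beta_reduce
    rw [real_inner_self_eq_norm_sq, hN1]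
    norm_num
  have hopen : ∀ᶠ s in 𝓝 s₀, IsUnit (T s) :=
    hTd.continuousAt.eventually (Units.isOpen.mem_nhds hunit)
  have hfin : DifferentiableAt ℝ (fun s => ‖Z s‖⁻¹ • Z s) s₀ :=
    ((hZ.norm ℝ hZ0).fun_inv (norm_ne_zero_iff.2 hZ0)).fun_smul hZ
  refine hfin.congr_of_eventuallyEq ?_
  filter_upwards [hpos, hopen, hN] with s h1 h2 h3
  have h4 := hNZ s h2 h3.2
  have h5 : ⟪N s₀, N s⟫ * ‖Z s‖ = 1 := by
    rw [← h3.1]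
    conv_rhs => rw [h4]
    rw [norm_smul, Real.norm_of_nonneg h1.le]
  rw [← eq_inv_of_mul_eq_one_left h5]
  exact h4

end Frame

/-- Jacobi's formula for the derivative of a determinant. -/
theorem hasDerivAt_det {ι : Type*} [Fintype ι] [DecidableEq ι] {A : ℝ → Matrix ι ι ℝ}
    {A' : Matrix ι ι ℝ} {t : ℝ} (hA : ∀ i j, HasDerivAt (fun s => A s i j) (A' i j) t)
    (hu : IsUnit (A t).det) :
    HasDerivAt (fun s => (A s).det) ((A t).det * ∑ i, ∑ j, (A t)⁻¹ i j * A' j i) t := by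
  have h1 : HasDerivAt (fun s => (A s).det)
      (∑ σ : Equiv.Perm ι, Equiv.Perm.sign σ •
        ∑ i, (∏ j ∈ Finset.univ.erase i, A t (σ j) j) • A' (σ i) i) t := by
    simp only [Matrix.det_apply]
    refine HasDerivAt.fun_sum fun σ _ => ?_
    have h2 := (HasDerivAt.fun_finsetProd (u := Finset.univ) fun i _ => hA (σ i) i).fun_const_smul
      ((Equiv.Perm.sign σ : ℤ) : ℝ)
    simpa [Units.smul_def, zsmul_eq_mul] using h2
  refine h1.congr_deriv ?_
  have h3 : ∀ i, ∑ j, (A t).det * ((A t)⁻¹ i j * A' j i)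
      = ((A t).updateCol i fun j => A' j i).det := by
    intro i
    have := congrFun (Matrix.det_smul_inv_mulVec_eq_cramer (A t) (fun j => A' j i) hu) i
    rw [Matrix.cramer_apply] at this
    rw [← this, ← Finset.mul_sum]
    rfl
  simp_rw [Finset.mul_sum, h3, Matrix.det_apply, Finset.smul_sum]
  rw [Finset.sum_comm]
  refine Finset.sum_congr rfl fun i _ => Finset.sum_congr rfl fun σ _ => ?_
  congr 1
  rw [← Finset.mul_prod_erase Finset.univ _ (Finset.mem_univ i), smul_eq_mul, mul_comm]
  congr 1
  · simp
  · refine Finset.prod_congr rfl fun j hj => ?_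
    rw [Matrix.updateCol_ne (Finset.ne_of_mem_erase hj)]

/-! ### Local geometry of a parametrized hypersurface -/

section Local

variable {m : ℕ}

theorem pd_inner {n : ℕ} {f g : E m → E n} {x : E m} (hf : DifferentiableAt ℝ f x)
    (hg : DifferentiableAt ℝ g x) (i : Fin m) :
    pd i (fun y => ⟪f y, g y⟫) x = ⟪pd i f x, g x⟫ + ⟪f x, pd i g x⟫ := by
  unfold pd
  rw [fderiv_inner_apply ℝ hf hg, add_comm]

theorem pd_congr {G : Type*} [NormedAddCommGroup G] [NormedSpace ℝ G] {f g : E m → G} {x : E m}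
    (h : f =ᶠ[𝓝 x] g) (i : Fin m) : pd i f x = pd i g x := by
  unfold pd
  rw [h.fderiv_eq]

theorem pd_const {G : Type*} [NormedAddCommGroup G] [NormedSpace ℝ G] (c : G) (x : E m)
    (i : Fin m) : pd i (fun _ => c) x = 0 := by
  simp [pd]

variable {Y N : E m → E (m + 1)} {x : E m}

theorem metric_eq_gram : metric Y x = Matrix.gram ℝ fun i => pd i Y x := rfl

theorem pd_pd_comm (hY : ∀ᶠ y in 𝓝 x, DifferentiableAt ℝ Y y)
    (hY2 : ∀ j, DifferentiableAt ℝ (pd j Y) x) (i j : Fin m) :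
    pd i (pd j Y) x = pd j (pd i Y) x := by
  have h1 : ∀ y, fderiv ℝ Y y
      = ∑ j, (EuclideanSpace.proj j : E m →L[ℝ] ℝ).smulRight (pd j Y y) := by
    intro y
    refine ContinuousLinearMap.coe_injective
      ((EuclideanSpace.basisFun (Fin m) ℝ).toBasis.ext fun k => ?_)
    simp [pd, PiLp.single_apply, ite_smul]
  have hd : DifferentiableAt ℝ (fderiv ℝ Y) x := by
    rw [show fderiv ℝ Y = _ from funext h1]
    refine DifferentiableAt.fun_sum fun j _ => ?_
    exact ((ContinuousLinearMap.smulRightL ℝ (E m) (E (m + 1))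
      (EuclideanSpace.proj j)).differentiableAt).comp x (hY2 j)
  have h2 : ∀ i j, pd i (pd j Y) x = fderiv ℝ (fderiv ℝ Y) x (EuclideanSpace.single i 1)
      (EuclideanSpace.single j 1) := by
    intro i j
    unfold pd
    rw [fderiv_clm_apply hd (differentiableAt_const _)]
    simp
  rw [h2, h2]
  exact second_derivative_symmetric_of_eventually (hY.mono fun y hy => hy.hasFDerivAt)
    hd.hasFDerivAt _ _

/-- The Christoffel symbols are the tangential components of the second derivatives of the
parametrization. -/
theorem christoffel_eq (hY : ∀ᶠ y in 𝓝 x, DifferentiableAt ℝ Y y)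
    (hY2 : ∀ j, DifferentiableAt ℝ (pd j Y) x) (k i j : Fin m) :
    christoffel Y k i j x = ∑ l, (metric Y x)⁻¹ k l * ⟪pd l Y x, pd i (pd j Y) x⟫ := by
  have h : ∀ i j l, pd i (fun y => metric Y y j l) x
      = ⟪pd i (pd j Y) x, pd l Y x⟫ + ⟪pd j Y x, pd i (pd l Y) x⟫ := fun i j l =>
    pd_inner (hY2 j) (hY2 l) i
  unfold christoffel
  rw [Finset.mul_sum]
  refine Finset.sum_congr rfl fun l _ => ?_
  rw [h, h, h, pd_pd_comm hY hY2 i j, pd_pd_comm hY hY2 i l, pd_pd_comm hY hY2 j l,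
    real_inner_comm (pd j Y x) (pd l (pd i Y) x), real_inner_comm (pd l Y x) (pd j (pd i Y) x)]
  ring

/-- The second fundamental form through the second derivatives of the parametrization. -/
theorem secondForm_eq (hY2 : ∀ j, DifferentiableAt ℝ (pd j Y) x) (hNd : DifferentiableAt ℝ N x)
    (hN : ∀ᶠ y in 𝓝 x, ∀ i, ⟪N y, pd i Y y⟫ = 0) (i j : Fin m) :
    secondForm Y N i j x = -⟪N x, pd i (pd j Y) x⟫ := by
  have h1 : (fun y => ⟪N y, pd j Y y⟫) =ᶠ[𝓝 x] fun _ => 0 := hN.mono fun y hy => hy j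
  have h2 := pd_inner hNd (hY2 j) i
  rw [pd_congr h1, pd_const] at h2
  unfold secondForm
  linarith

/-- Gauss' formula: the Hessian of the parametrization is normal to the hypersurface. -/
theorem hessian_self (hY : ∀ᶠ y in 𝓝 x, DifferentiableAt ℝ Y y)
    (hY2 : ∀ j, DifferentiableAt ℝ (pd j Y) x) (hli : LinearIndependent ℝ fun i => pd i Y x)
    {n : E (m + 1)} (hn : ‖n‖ = 1) (hna : ∀ i, ⟪n, pd i Y x⟫ = 0) (i j : Fin m) :
    hessian Y Y i j x = ⟪n, pd i (pd j Y) x⟫ • n := by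
  unfold hessian
  rw [sub_eq_iff_eq_add']
  simp_rw [christoffel_eq hY hY2]
  exact frame_expansion hli hn hna _

end Local

/-! ### Evolution of the geometry of a moving frame -/

section Evolution

variable {m : ℕ} {a : Fin m → ℝ → E (m + 1)} {A : E (m + 1) →L[ℝ] E (m + 1)} {t : ℝ}

theorem hasDerivAt_gram (ha : ∀ i, HasDerivAt (a i) (A (a i t)) t) (i j : Fin m) :
    HasDerivAt (fun s => Matrix.gram ℝ (fun i => a i s) i j)
      (⟪a i t, A (a j t)⟫ + ⟪A (a i t), a j t⟫) t :=
  (ha i).inner ℝ (ha j)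

theorem sum_gram_inv_mul_swap (b : Fin m → E (m + 1)) (f : Fin m → Fin m → ℝ) :
    ∑ i, ∑ j, (Matrix.gram ℝ b)⁻¹ i j * f j i = ∑ i, ∑ j, (Matrix.gram ℝ b)⁻¹ i j * f i j := by
  rw [Finset.sum_comm]
  exact Finset.sum_congr rfl fun i _ => Finset.sum_congr rfl fun j _ => by rw [gram_inv_symm]

theorem sum_gram_inv_mul_gram {b : Fin m → E (m + 1)} (hb : LinearIndependent ℝ b) :
    ∑ i, ∑ j, (Matrix.gram ℝ b)⁻¹ i j * Matrix.gram ℝ b i j = m := by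
  refine (sum_gram_inv_mul_swap b fun i j => Matrix.gram ℝ b i j).symm.trans ?_
  have h := congrArg Matrix.trace (Matrix.nonsing_inv_mul _ (isUnit_det_gram hb))
  rw [Matrix.trace_one, Fintype.card_fin] at h
  rw [← h]
  rfl

theorem hasDerivAt_sqrt_det_gram (hli : LinearIndependent ℝ fun i => a i t)
    (ha : ∀ i, HasDerivAt (a i) (A (a i t)) t) :
    HasDerivAt (fun s => √(Matrix.gram ℝ fun i => a i s).det)
      ((∑ i, ∑ j, (Matrix.gram ℝ fun i => a i t)⁻¹ i j * ⟪A (a i t), a j t⟫) *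
        √(Matrix.gram ℝ fun i => a i t).det) t := by
  have hpos : 0 < (Matrix.gram ℝ fun i => a i t).det :=
    (Matrix.posDef_gram_of_linearIndependent hli).det_pos
  have h1 := (hasDerivAt_det (A' := Matrix.of fun i j => ⟪a i t, A (a j t)⟫ + ⟪A (a i t), a j t⟫)
    (hasDerivAt_gram ha) (isUnit_det_gram hli)).sqrt hpos.ne'
  refine h1.congr_deriv ?_
  have h2 : ∑ i, ∑ j, (Matrix.gram ℝ fun i => a i t)⁻¹ i j *
      (⟪a j t, A (a i t)⟫ + ⟪A (a j t), a i t⟫)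
      = 2 * ∑ i, ∑ j, (Matrix.gram ℝ fun i => a i t)⁻¹ i j * ⟪A (a i t), a j t⟫ := by
    simp_rw [mul_add, Finset.sum_add_distrib]
    rw [sum_gram_inv_mul_swap _ fun i j => ⟪A (a i t), a j t⟫, two_mul]
    congr 1
    exact Finset.sum_congr rfl fun i _ => Finset.sum_congr rfl fun j _ => by rw [real_inner_comm]
  simp only [Matrix.of_apply]
  rw [h2, div_eq_iff (by positivity)]
  have h3 := Real.mul_self_sqrt hpos.le
  linear_combination (2 * ∑ i, ∑ j, (Matrix.gram ℝ fun i => a i t)⁻¹ i j *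
    ⟪A (a i t), a j t⟫) * (-h3)

variable {N : ℝ → E (m + 1)} {N' : E (m + 1)}

theorem inner_deriv_unit_normal_self (hNd : HasDerivAt N N' t) (hN : ∀ᶠ s in 𝓝 t, ‖N s‖ = 1) :
    ⟪N', N t⟫ = 0 := by
  have h1 := hNd.inner ℝ hNd
  have h2 : (fun s => ⟪N s, N s⟫) =ᶠ[𝓝 t] fun _ => (1 : ℝ) := hN.mono fun s hs => by
    beta_reduce
    rw [real_inner_self_eq_norm_sq, hs, one_pow]
  have h3 := h1.unique ((hasDerivAt_const t (1 : ℝ)).congr_of_eventuallyEq h2)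
  rw [real_inner_comm N' (N t)] at h3
  linarith [real_inner_comm N' (N t)]

theorem inner_deriv_unit_normal_frame (ha : ∀ i, HasDerivAt (a i) (A (a i t)) t)
    (hNd : HasDerivAt N N' t) (hN : ∀ᶠ s in 𝓝 t, ∀ i, ⟪N s, a i s⟫ = 0) (i : Fin m) :
    ⟪N', a i t⟫ = -⟪N t, A (a i t)⟫ := by
  have h1 := hNd.inner ℝ (ha i)
  have h2 : (fun s => ⟪N s, a i s⟫) =ᶠ[𝓝 t] fun _ => (0 : ℝ) := hN.mono fun s hs => hs i
  have h3 := h1.unique ((hasDerivAt_const t (0 : ℝ)).congr_of_eventuallyEq h2)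
  linarith

/-- The derivative of the unit normal, tested against a vector `v`: only the tangential part of `v`
contributes. -/
theorem inner_deriv_unit_normal (hli : LinearIndependent ℝ fun i => a i t)
    (ha : ∀ i, HasDerivAt (a i) (A (a i t)) t) (hNd : HasDerivAt N N' t)
    (hN : ∀ᶠ s in 𝓝 t, ‖N s‖ = 1 ∧ ∀ i, ⟪N s, a i s⟫ = 0) (v : E (m + 1)) :
    ⟪N', v⟫ = -∑ i, (∑ j, (Matrix.gram ℝ fun i => a i t)⁻¹ i j * ⟪a j t, v⟫) *
      ⟪N t, A (a i t)⟫ := by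
  have h0 := hN.self_of_nhds
  conv_lhs => rw [frame_expansion hli h0.1 h0.2 v]
  rw [inner_add_right, inner_sum, inner_smul_right,
    inner_deriv_unit_normal_self hNd (hN.mono fun s hs => hs.1), mul_zero, add_zero,
    ← Finset.sum_neg_distrib]
  refine Finset.sum_congr rfl fun i _ => ?_
  rw [inner_smul_right, inner_deriv_unit_normal_frame ha hNd (hN.mono fun s hs => hs.2), mul_neg]

/-- Evolution of the normal component of the velocity field. -/
theorem hasDerivAt_inner_normal {η : E (m + 1) → E (m + 1)} {p : ℝ → E (m + 1)}
    (hη : DifferentiableAt ℝ η (p t)) (hp : HasDerivAt p (η (p t)) t)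
    (hli : LinearIndependent ℝ fun i => a i t)
    (ha : ∀ i, HasDerivAt (a i) (fderiv ℝ η (p t) (a i t)) t) (hNd : HasDerivAt N N' t)
    (hN : ∀ᶠ s in 𝓝 t, ‖N s‖ = 1 ∧ ∀ i, ⟪N s, a i s⟫ = 0) :
    HasDerivAt (fun s => ⟪η (p s), N s⟫) (⟪η (p t), N t⟫ * (divergence η (p t) -
      ∑ i, ∑ j, (Matrix.gram ℝ fun i => a i t)⁻¹ i j * ⟪fderiv ℝ η (p t) (a i t), a j t⟫)) t := by
  have h0 := hN.self_of_nhds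
  have h1 := (hη.hasFDerivAt.comp_hasDerivAt t hp).inner ℝ hNd
  refine h1.congr_deriv ?_
  unfold divergence
  rw [trace_eq_frame hli h0.1 h0.2, add_sub_cancel_left, Function.comp_apply,
    real_inner_comm N' (η (p t)), inner_deriv_unit_normal hli ha hNd hN]
  have h2 : ⟪fderiv ℝ η (p t) (η (p t)), N t⟫
      = ∑ i, (∑ j, (Matrix.gram ℝ fun i => a i t)⁻¹ i j * ⟪a j t, η (p t)⟫) *
        ⟪N t, fderiv ℝ η (p t) (a i t)⟫ + ⟪η (p t), N t⟫ * ⟪fderiv ℝ η (p t) (N t), N t⟫ := by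
    conv_lhs => rw [frame_expansion hli h0.1 h0.2 (η (p t))]
    simp only [map_add, map_sum, map_smul, inner_add_left, sum_inner, real_inner_smul_left]
    simp only [real_inner_comm (N t)]
  rw [h2]
  ring

/-- Evolution of the pairing of the normal with a moving vector `q`; this gives the evolution of
the second fundamental form when `q` is a second derivative of the parametrization. -/
theorem hasDerivAt_neg_inner_normal {q : ℝ → E (m + 1)} {q' : E (m + 1)}
    (hq : HasDerivAt q q' t) (hli : LinearIndependent ℝ fun i => a i t)
    (ha : ∀ i, HasDerivAt (a i) (A (a i t)) t) (hNd : HasDerivAt N N' t)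
    (hN : ∀ᶠ s in 𝓝 t, ‖N s‖ = 1 ∧ ∀ i, ⟪N s, a i s⟫ = 0) :
    HasDerivAt (fun s => -⟪N s, q s⟫)
      (-⟪q' - ∑ k, (∑ l, (Matrix.gram ℝ fun i => a i t)⁻¹ k l * ⟪a l t, q t⟫) • A (a k t), N t⟫)
      t := by
  refine (hNd.inner ℝ hq).neg.congr_deriv ?_
  rw [inner_deriv_unit_normal hli ha hNd hN, inner_sub_left, sum_inner, real_inner_comm q']
  simp_rw [real_inner_smul_left, real_inner_comm (N t)]
  ring

/-- A product is differentiable at a zero of one differentiable factor as soon as the other factor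
is continuous there. -/
theorem hasDerivAt_mul_of_eq_zero {u v : ℝ → ℝ} {v' : ℝ} (hu : ContinuousAt u t)
    (hv : HasDerivAt v v' t) (h0 : v t = 0) : HasDerivAt (fun s => u s * v s) (u t * v') t := by
  rw [hasDerivAt_iff_tendsto_slope] at hv ⊢
  refine ((hu.tendsto.mono_left nhdsWithin_le_nhds).mul hv).congr fun s => ?_
  simp only [slope_def_field, h0, mul_zero, sub_zero]
  ring

/-- Derivative of the trace `gⁱʲ hᵢⱼ` at a time at which `h = κ g`. Writing the trace as
`gⁱʲ (hᵢⱼ - κ gᵢⱼ) + κ m`, the inverse matrix need not be differentiated. -/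
theorem hasDerivAt_trace_of_umbilic {h : Fin m → Fin m → ℝ → ℝ} {h' : Fin m → Fin m → ℝ} {κ : ℝ}
    (hli : LinearIndependent ℝ fun i => a i t) (ha : ∀ i, HasDerivAt (a i) (A (a i t)) t)
    (hh : ∀ i j, HasDerivAt (h i j) (h' i j) t)
    (hκ : ∀ i j, h i j t = κ * Matrix.gram ℝ (fun i => a i t) i j) :
    HasDerivAt (fun s => ∑ i, ∑ j, (Matrix.gram ℝ fun i => a i s)⁻¹ i j * h i j s)
      (∑ i, ∑ j, (Matrix.gram ℝ fun i => a i t)⁻¹ i j * h' i j -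
        2 * κ * ∑ i, ∑ j, (Matrix.gram ℝ fun i => a i t)⁻¹ i j * ⟪A (a i t), a j t⟫) t := by
  have hgc : ContinuousAt (fun s => Matrix.gram ℝ fun i => a i s) t :=
    continuousAt_pi.2 fun i => continuousAt_pi.2 fun j => (hasDerivAt_gram ha i j).continuousAt
  have hinvc : ContinuousAt (fun s => (Matrix.gram ℝ fun i => a i s)⁻¹) t := by
    refine ContinuousAt.comp (f := fun s => Matrix.gram ℝ fun i => a i s)
      (g := fun B : Matrix (Fin m) (Fin m) ℝ => B⁻¹) (continuousAt_matrix_inv _ ?_) hgc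
    rw [Ring.inverse_eq_inv']
    exact continuousAt_inv₀ (isUnit_det_gram hli).ne_zero
  have h1 : HasDerivAt (fun s => ∑ i, ∑ j, (Matrix.gram ℝ fun i => a i s)⁻¹ i j *
      (h i j s - κ * Matrix.gram ℝ (fun i => a i s) i j))
      (∑ i, ∑ j, (Matrix.gram ℝ fun i => a i t)⁻¹ i j *
        (h' i j - κ * (⟪a i t, A (a j t)⟫ + ⟪A (a i t), a j t⟫))) t := by
    refine HasDerivAt.fun_sum fun i _ => HasDerivAt.fun_sum fun j _ => ?_
    refine hasDerivAt_mul_of_eq_zero (continuousAt_pi.1 (continuousAt_pi.1 hinvc i) j)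
      ((hh i j).sub ((hasDerivAt_gram ha i j).const_mul κ)) ?_
    simp [hκ]
  have hli' : ∀ᶠ s in 𝓝 t, LinearIndependent ℝ fun i => a i s := by
    have hdet : ContinuousAt (fun s => (Matrix.gram ℝ fun i => a i s).det) t :=
      (Continuous.matrix_det continuous_id).continuousAt.comp hgc
    filter_upwards [hdet.eventually_ne (isUnit_det_gram hli).ne_zero] with s hs
    exact Matrix.linearIndependent_of_det_gram_ne_zero hs
  have h2 := (h1.add_const (κ * m)).congr_of_eventuallyEq
    (f₁ := fun s => ∑ i, ∑ j, (Matrix.gram ℝ fun i => a i s)⁻¹ i j * h i j s) (by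
      filter_upwards [hli'] with s hs
      simp_rw [mul_sub, mul_left_comm _ κ, Finset.sum_sub_distrib, ← Finset.mul_sum]
      rw [sum_gram_inv_mul_gram hs, sub_add_cancel])
  refine h2.congr_deriv ?_
  have h3 : ∑ i, ∑ j, (Matrix.gram ℝ fun i => a i t)⁻¹ i j * ⟪a i t, A (a j t)⟫
      = ∑ i, ∑ j, (Matrix.gram ℝ fun i => a i t)⁻¹ i j * ⟪A (a i t), a j t⟫ := by
    rw [← sum_gram_inv_mul_swap _ fun i j => ⟪A (a i t), a j t⟫]
    exact Finset.sum_congr rfl fun i _ => Finset.sum_congr rfl fun j _ => by rw [real_inner_comm]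
  simp_rw [mul_sub, mul_left_comm _ κ, mul_add, Finset.sum_sub_distrib, Finset.sum_add_distrib,
    ← Finset.mul_sum]
  rw [h3]
  ring

end Evolution

/-! ### Hypersurfaces contained in a sphere -/

section Sphere

variable {m : ℕ} {X N : E m → E (m + 1)} {x : E m} {c : E (m + 1)} {R : ℝ}

/-- A continuous unit normal along a hypersurface contained in a sphere is locally `κ (X - c)` with
a constant `κ = ±1 / R`. -/
theorem exists_normal_eq_smul_of_sphere (hR : 0 < R)
    (hX : ∀ᶠ y in 𝓝 x, DifferentiableAt ℝ X y)
    (hli : ∀ᶠ y in 𝓝 x, LinearIndependent ℝ fun i => pd i X y)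
    (hXR : ∀ᶠ y in 𝓝 x, ‖X y - c‖ = R) (hNc : ContinuousAt N x)
    (hN : ∀ᶠ y in 𝓝 x, ‖N y‖ = 1 ∧ ∀ i, ⟪N y, pd i X y⟫ = 0) :
    ∃ κ : ℝ, κ ^ 2 = 1 / R ^ 2 ∧ ∀ᶠ y in 𝓝 x, N y = κ • (X y - c) := by
  have hsq : ∀ᶠ y in 𝓝 x, ⟪N y, X y - c⟫ ^ 2 = R ^ 2 ∧
      N y = (⟪N y, X y - c⟫ / R ^ 2) • (X y - c) := by
    filter_upwards [hX, hli, hXR, hXR.eventually_nhds, hN] with y h1 h2 h3 h4 h5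
    have horth : ∀ i, ⟪pd i X y, X y - c⟫ = 0 := by
      intro i
      have h6 : (fun z => ⟪X z - c, X z - c⟫) =ᶠ[𝓝 y] fun _ => R ^ 2 := h4.mono fun z hz => by
        beta_reduce
        rw [real_inner_self_eq_norm_sq, hz]
      have h7 := pd_inner (h1.sub_const c) (h1.sub_const c) i
      have h8 : pd i (fun z => X z - c) y = pd i X y := by
        unfold pd
        rw [fderiv_sub_const]
      rw [pd_congr h6, pd_const, h8, real_inner_comm (pd i X y) (X y - c)] at h7
      linarith
    have h6 : X y - c = ⟪N y, X y - c⟫ • N y := by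
      conv_lhs => rw [frame_expansion h2 h5.1 h5.2 (X y - c)]
      simp [horth]
    have h7 : ⟪N y, X y - c⟫ ^ 2 = R ^ 2 := by
      have h8 := congrArg norm h6
      rw [norm_smul, h5.1, mul_one, h3, Real.norm_eq_abs] at h8
      rw [h8, sq_abs]
    refine ⟨h7, ?_⟩
    conv_rhs => rw [h6]
    rw [inner_smul_right, real_inner_self_eq_norm_sq, h5.1, one_pow, mul_one, smul_smul,
      div_mul_eq_mul_div, ← sq, h7, div_self (by positivity), one_smul]
  have hx := hsq.self_of_nhds
  have hcont : ContinuousAt (fun y => ⟪N y, X y - c⟫) x :=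
    hNc.inner (hX.self_of_nhds.continuousAt.sub continuousAt_const)
  have hclose : ∀ᶠ y in 𝓝 x, |⟪N y, X y - c⟫ - ⟪N x, X x - c⟫| < R := by
    have := Metric.tendsto_nhds.1 hcont.tendsto R hR
    simpa [Real.dist_eq] using this
  refine ⟨⟪N x, X x - c⟫ / R ^ 2, ?_, ?_⟩
  · rw [div_pow, hx.1]
    field_simp
  · filter_upwards [hsq, hclose] with y h1 h2
    have h3 : ⟪N y, X y - c⟫ = ⟪N x, X x - c⟫ := by
      rcases sq_eq_sq_iff_eq_or_eq_neg.1 (h1.1.trans hx.1.symm) with h | h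
      · exact h
      · -- opposite values would differ by `2 R`
        exfalso
        have h4 : |⟪N x, X x - c⟫| = R := by
          rw [← abs_of_pos hR]
          exact sq_eq_sq_iff_abs_eq_abs _ _ |>.1 hx.1
        rw [h, show -⟪N x, X x - c⟫ - ⟪N x, X x - c⟫ = -(2 * ⟪N x, X x - c⟫) by ring, abs_neg,
          abs_mul, h4] at h2
        norm_num at h2
        linarith
    rw [← h3]
    exact h1.2

/-- The Laplacian of the normal component of a vector field along a hypersurface with unit normal
`κ (X - c)`. -/
theorem laplaceBeltrami_inner_normal {f : E m → E (m + 1)} {κ : ℝ}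
    (hX : ∀ᶠ y in 𝓝 x, DifferentiableAt ℝ X y) (hX2 : ∀ j, DifferentiableAt ℝ (pd j X) x)
    (hli : LinearIndependent ℝ fun i => pd i X x)
    (hf : ∀ᶠ y in 𝓝 x, DifferentiableAt ℝ f y) (hf2 : ∀ j, DifferentiableAt ℝ (pd j f) x)
    (hN : ∀ᶠ y in 𝓝 x, ‖N y‖ = 1 ∧ ∀ i, ⟪N y, pd i X y⟫ = 0)
    (hκ : ∀ᶠ y in 𝓝 x, N y = κ • (X y - c)) :
    laplaceBeltrami X (fun y => ⟪f y, N y⟫) x =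
      ∑ i, ∑ j, (metric X x)⁻¹ i j * ⟪hessian X f i j x, N x⟫
        + 2 * κ * ∑ i, ∑ j, (metric X x)⁻¹ i j * ⟪pd i f x, pd j X x⟫
        - κ ^ 2 * m * ⟪f x, N x⟫ := by
  have hN0 := hN.self_of_nhds
  have hpdN : ∀ᶠ y in 𝓝 x, DifferentiableAt ℝ N y ∧ ∀ i, pd i N y = κ • pd i X y := by
    filter_upwards [hκ.eventually_nhds, hX] with y h1 h2
    have h3 : N =ᶠ[𝓝 y] fun z => κ • (X z - c) := h1
    have h4 : HasFDerivAt (fun z => κ • (X z - c)) (κ • fderiv ℝ X y) y :=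
      (h2.hasFDerivAt.sub_const c).fun_const_smul κ
    have h5 := h4.congr_of_eventuallyEq h3
    refine ⟨h5.differentiableAt, fun i => ?_⟩
    unfold pd
    rw [h5.fderiv]
    rfl
  have hNd : DifferentiableAt ℝ N x := hpdN.self_of_nhds.1
  have hpdu : ∀ j, pd j (fun y => ⟪f y, N y⟫) =ᶠ[𝓝 x]
      fun y => ⟪pd j f y, N y⟫ + κ * ⟪f y, pd j X y⟫ := by
    intro j
    filter_upwards [hpdN, hf] with y h1 h2
    rw [pd_inner h2 h1.1, h1.2, inner_smul_right]
  have hfx := hf.self_of_nhds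
  -- the normal component of the second derivatives of `X` is `-κ g`
  have hsec : ∀ i j, ⟪N x, pd i (pd j X) x⟫ = -(κ * metric X x i j) := by
    intro i j
    have h1 := secondForm_eq hX2 hNd (hN.mono fun y hy => hy.2) i j
    unfold secondForm at h1
    rw [hpdN.self_of_nhds.2, real_inner_smul_left] at h1
    have h2 : metric X x i j = ⟪pd i X x, pd j X x⟫ := rfl
    rw [h2]
    linarith
  have hess : ∀ i j, hessian X (fun y => ⟪f y, N y⟫) i j x = ⟪hessian X f i j x, N x⟫
      + κ * (⟪pd j f x, pd i X x⟫ + ⟪pd i f x, pd j X x⟫) - κ ^ 2 * ⟪f x, N x⟫ * metric X x i j := by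
    intro i j
    have h1 : pd i (pd j fun y => ⟪f y, N y⟫) x = ⟪pd i (pd j f) x, N x⟫
        + κ * ⟪pd j f x, pd i X x⟫ + κ * (⟪pd i f x, pd j X x⟫ + ⟪f x, pd i (pd j X) x⟫) := by
      have h2 : pd i (pd j fun y => ⟪f y, N y⟫) x
          = pd i (fun y => ⟪pd j f y, N y⟫) x + κ * pd i (fun y => ⟪f y, pd j X y⟫) x := by
        rw [pd_congr (hpdu j)]
        unfold pd
        rw [fderiv_fun_add, fderiv_const_mul]
        · rfl
        · exact hfx.inner ℝ (hX2 j)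
        · exact (hf2 j).inner ℝ hNd
        · exact (hfx.inner ℝ (hX2 j)).const_mul κ
      rw [h2, pd_inner (hf2 j) hNd, pd_inner hfx (hX2 j), hpdN.self_of_nhds.2, inner_smul_right]
    have h4 := hessian_self hX hX2 hli hN0.1 hN0.2 i j
    rw [hsec] at h4
    have h5 := congrArg (fun v => ⟪f x, v⟫) h4
    unfold hessian at h5 ⊢
    simp only [inner_sub_right, inner_sum, inner_smul_right] at h5
    rw [h1, inner_sub_left, sum_inner]
    simp_rw [(hpdu _).self_of_nhds, real_inner_smul_left, smul_eq_mul, mul_add,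
      Finset.sum_add_distrib, mul_left_comm _ κ, ← Finset.mul_sum]
    linear_combination κ * h5
  unfold laplaceBeltrami
  simp_rw [hess, metric_eq_gram, mul_sub, mul_add, Finset.sum_sub_distrib, Finset.sum_add_distrib,
    mul_left_comm _ κ, mul_left_comm _ (κ ^ 2 * _), ← Finset.mul_sum]
  rw [sum_gram_inv_mul_gram hli, sum_gram_inv_mul_swap _ fun i j => ⟪pd i f x, pd j X x⟫]
  ring

end Sphere

/-! ### The transported hypersurface -/

section Transport

variable {m : ℕ} {η : E (m + 1) → E (m + 1)} {J : Set ℝ} {F : ℝ → E (m + 1) → E (m + 1)}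
  {M : Set (E (m + 1))} {ν : ℝ → E (m + 1) → E (m + 1)} {U : Set (E m)} {X : E m → E (m + 1)}
  {x : E m} {t : ℝ}

theorem IsLocalParam.contDiffAt (hX : IsLocalParam M U X) (hx : x ∈ U) : ContDiffAt ℝ 2 X x :=
  hX.contDiffOn.contDiffAt (hX.isOpen.mem_nhds hx)

theorem IsLocalParam.differentiableAt (hX : IsLocalParam M U X) (hx : x ∈ U) :
    DifferentiableAt ℝ X x :=
  (hX.contDiffAt hx).differentiableAt two_ne_zero

theorem IsLocalParam.mem (hX : IsLocalParam M U X) (hx : x ∈ U) : X x ∈ M := by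
  obtain ⟨V, _, hV⟩ := hX.image_eq
  exact (hV ▸ mem_image_of_mem X hx : X x ∈ M ∩ V).1

theorem IsLocalParam.differentiableAt_flow (hη : ContDiff ℝ 1 η) (hJ : IsOpen J)
    (hJ' : J.OrdConnected) (h0 : (0 : ℝ) ∈ J) (hF : IsFlowMap η J F) (hX : IsLocalParam M U X)
    (ht : t ∈ J) (hx : x ∈ U) : DifferentiableAt ℝ (F t ∘ X) x :=
  differentiableAt_flow_comp hη hJ hJ' h0 hF.zero hF.deriv ht (hX.differentiableAt hx)

/-- The transported parametrizations are immersions. -/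
theorem IsLocalParam.linearIndependent_flow (hη : ContDiff ℝ 1 η) (hJ : IsOpen J)
    (hJ' : J.OrdConnected) (h0 : (0 : ℝ) ∈ J) (hF : IsFlowMap η J F) (hX : IsLocalParam M U X)
    (ht : t ∈ J) (hx : x ∈ U) : LinearIndependent ℝ fun i => pd i (F t ∘ X) x := by
  have h1 := (EuclideanSpace.basisFun (Fin m) ℝ).toBasis.linearIndependent
  have h2 := h1.map' ((fderiv ℝ (F t) (X x)).comp (fderiv ℝ X x)).toLinearMap
    (LinearMap.ker_eq_bot.2 ((fderiv_flow_injective hη hJ hJ' h0 hF.zero hF.deriv ht (X x)).comp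
      (hX.immersion x hx)))
  have h3 : (fun i => pd i (F t ∘ X) x) = ((fderiv ℝ (F t) (X x)).comp (fderiv ℝ X x)).toLinearMap ∘
      (EuclideanSpace.basisFun (Fin m) ℝ).toBasis := by
    funext i
    simp only [pd, Function.comp_apply, OrthonormalBasis.coe_toBasis,
      EuclideanSpace.basisFun_apply]
    exact fderiv_flow_comp hη hJ hJ' h0 hF.zero hF.deriv ht (hX.differentiableAt hx) _
  rw [h3]
  exact h2

/-- A unit normal field along the transported hypersurface is orthogonal to the coordinate
vectors. -/
theorem IsLocalParam.normal_flow (hη : ContDiff ℝ 1 η) (hJ : IsOpen J)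
    (hJ' : J.OrdConnected) (h0 : (0 : ℝ) ∈ J) (hF : IsFlowMap η J F) (hX : IsLocalParam M U X)
    (hν : ∀ t ∈ J, IsUnitNormal (F t '' M) (ν t)) (ht : t ∈ J) (hx : x ∈ U) :
    ‖ν t (F t (X x))‖ = 1 ∧ ∀ i, ⟪ν t (F t (X x)), pd i (F t ∘ X) x⟫ = 0 := by
  have h1 := hν t ht _ (mem_image_of_mem (F t) (hX.mem hx))
  refine ⟨h1.1, fun i => h1.2 _ ?_⟩
  have h2 := (hX.differentiableAt_flow hη hJ hJ' h0 hF ht hx).hasFDerivAt.hasFDerivWithinAt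
    (s := U)
  have h3 : EuclideanSpace.single i (1 : ℝ) ∈ tangentConeAt ℝ U x := by
    rw [tangentConeAt_of_mem_nhds (hX.isOpen.mem_nhds hx)]
    exact mem_univ _
  refine tangentConeAt_mono ?_ (h2.mapsTo_tangent_cone h3)
  rintro _ ⟨y, hy, rfl⟩
  exact mem_image_of_mem (F t) (hX.mem hy)

theorem IsLocalParam.continuousAt_normal_space (hX : IsLocalParam M U X)
    (hνc : ContinuousOn (fun p : ℝ × E (m + 1) => ν p.1 (F p.1 p.2)) (J ×ˢ M)) (ht : t ∈ J)
    (hx : x ∈ U) : ContinuousAt (fun y => ν t (F t (X y))) x := by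
  have h1 : ContinuousOn (fun y => (t, X y)) U :=
    continuousOn_const.prodMk hX.contDiffOn.continuousOn
  exact (hνc.comp h1 fun y hy => ⟨ht, hX.mem hy⟩).continuousAt (hX.isOpen.mem_nhds hx)

theorem IsLocalParam.continuousAt_normal_time (hJ : IsOpen J) (hX : IsLocalParam M U X)
    (hνc : ContinuousOn (fun p : ℝ × E (m + 1) => ν p.1 (F p.1 p.2)) (J ×ˢ M)) (ht : t ∈ J)
    (hx : x ∈ U) : ContinuousAt (fun s => ν s (F s (X x))) t := by
  have h1 : ContinuousOn (fun s : ℝ => (s, X x)) J := by fun_prop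
  exact (hνc.comp h1 fun s hs => ⟨hs, hX.mem hx⟩).continuousAt (hJ.mem_nhds ht)

end Transport

end GeomFlow

open GeomFlow in
theorem proposition2p1 {m : ℕ}
    (η : GeomFlow.E (m + 1) → GeomFlow.E (m + 1)) (hη : ContDiff ℝ 2 η)
    (J : Set ℝ) (hJ : IsOpen J) (hJ' : J.OrdConnected) (h0 : (0 : ℝ) ∈ J)
    (F : ℝ → GeomFlow.E (m + 1) → GeomFlow.E (m + 1)) (hF : GeomFlow.IsFlowMap η J F)
    (M : Set (GeomFlow.E (m + 1))) (hM : GeomFlow.IsHypersurface M)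
    -- `ν t` is a unit normal field along `M_t = F_t(M)`, continuous in time and space
    (ν : ℝ → GeomFlow.E (m + 1) → GeomFlow.E (m + 1))
    (hν : ∀ t ∈ J, GeomFlow.IsUnitNormal (F t '' M) (ν t))
    (hνc : ContinuousOn (fun p : ℝ × GeomFlow.E (m + 1) => ν p.1 (F p.1 p.2)) (J ×ˢ M))
    -- local coordinates of `M`, transported to `M_t` by `F_t`
    (U : Set (GeomFlow.E m)) (X : GeomFlow.E m → GeomFlow.E (m + 1))
    (hX : GeomFlow.IsLocalParam M U X) (x : GeomFlow.E m) (hx : x ∈ U) :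
    (∀ t ∈ J,
      HasDerivAt (fun s => GeomFlow.areaDensity (F s ∘ X) x)
        (GeomFlow.tangentialDiv η (F t ∘ X) x * GeomFlow.areaDensity (F t ∘ X) x) t ∧
      HasDerivAt (fun s => ⟪η (F s (X x)), ν s (F s (X x))⟫)
        (⟪η (F t (X x)), ν t (F t (X x))⟫ *
          (GeomFlow.divergence η (F t (X x)) - GeomFlow.tangentialDiv η (F t ∘ X) x)) t ∧
      ∀ i j : Fin m,
        HasDerivAt (fun s => GeomFlow.secondForm (F s ∘ X) (ν s ∘ F s ∘ X) i j x)
          (-⟪GeomFlow.hessian (F t ∘ X) (η ∘ F t ∘ X) i j x, ν t (F t (X x))⟫) t) ∧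
    (∀ (c : GeomFlow.E (m + 1)) (R : ℝ), 0 < R → M = Metric.sphere c R →
      HasDerivAt (fun s => GeomFlow.meanCurvature (F s ∘ X) (ν s ∘ F s ∘ X) x)
        (-GeomFlow.laplaceBeltrami X (fun y => ⟪η (X y), ν 0 (X y)⟫) x
          - (m : ℝ) / R ^ 2 * ⟪η (X x), ν 0 (X x)⟫) 0) := by
  have hη1 : ContDiff ℝ 1 η := hη.of_le one_le_two
  have hηd : ∀ p, DifferentiableAt ℝ η p := fun p => hη1.differentiable one_ne_zero p
  have hU : ∀ᶠ y in 𝓝 x, y ∈ U := hX.isOpen.mem_nhds hx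
  have hYd : ∀ s ∈ J, ∀ᶠ y in 𝓝 x, DifferentiableAt ℝ (F s ∘ X) y := fun s hs =>
    hU.mono fun y hy => hX.differentiableAt_flow hη1 hJ hJ' h0 hF hs hy
  have hli : ∀ s ∈ J, LinearIndependent ℝ fun i => pd i (F s ∘ X) x := fun s hs =>
    hX.linearIndependent_flow hη1 hJ hJ' h0 hF hs hx
  have hN : ∀ s ∈ J, ∀ᶠ y in 𝓝 x, ‖(ν s ∘ F s ∘ X) y‖ = 1 ∧
      ∀ i, ⟪(ν s ∘ F s ∘ X) y, pd i (F s ∘ X) y⟫ = 0 := fun s hs =>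
    hU.mono fun y hy => hX.normal_flow hη1 hJ hJ' h0 hF hν hs hy
  have hNt : ∀ t ∈ J, ∀ᶠ s in 𝓝 t, ‖ν s (F s (X x))‖ = 1 ∧
      ∀ i, ⟪ν s (F s (X x)), pd i (F s ∘ X) x⟫ = 0 := fun t ht =>
    (eventually_mem_set.2 (hJ.mem_nhds ht)).mono fun s hs => (hN s hs).self_of_nhds
  have h2 : ∀ t ∈ J, ∀ i j, DifferentiableAt ℝ (pd j (F t ∘ X)) x ∧
      HasDerivAt (fun s => pd i (pd j (F s ∘ X)) x) (pd i (pd j (η ∘ F t ∘ X)) x) t :=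
    fun t ht i j => flow_comp_second_derivative hη hJ hJ' h0 hF.zero hF.deriv ht
      (hX.contDiffAt hx) _ _
  have hY2 : ∀ t ∈ J, ∀ j, DifferentiableAt ℝ (pd j (F t ∘ X)) x := fun t ht j => (h2 t ht j j).1
  have hηpd : ∀ t ∈ J, ∀ i, pd i (η ∘ F t ∘ X) x
      = fderiv ℝ η (F t (X x)) (pd i (F t ∘ X) x) := fun t ht i =>
    fderiv_field_comp hη1 (hYd t ht).self_of_nhds _
  have ha : ∀ t ∈ J, ∀ i, HasDerivAt (fun s => pd i (F s ∘ X) x)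
      (fderiv ℝ η (F t (X x)) (pd i (F t ∘ X) x)) t := fun t ht i => by
    rw [← hηpd t ht]
    exact hasDerivAt_fderiv_flow_comp hη1 hJ hJ' h0 hF.zero hF.deriv ht (hX.differentiableAt hx) _
  have hNx : ∀ s ∈ J, DifferentiableAt ℝ (ν s ∘ F s ∘ X) x := fun s hs =>
    differentiableAt_unit_normal (a := fun i y => pd i (F s ∘ X) y) (hli s hs) (hY2 s hs)
      (hX.continuousAt_normal_space hνc hs hx) (hN s hs)
  have hNd : ∀ t ∈ J, HasDerivAt (fun s => ν s (F s (X x)))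
      (deriv (fun s => ν s (F s (X x))) t) t := fun t ht =>
    (differentiableAt_unit_normal (a := fun i s => pd i (F s ∘ X) x) (hli t ht)
      (fun i => (ha t ht i).differentiableAt)
      (hX.continuousAt_normal_time hJ hνc ht hx) (hNt t ht)).hasDerivAt
  have hsec : ∀ t ∈ J, ∀ i j, HasDerivAt
      (fun s => secondForm (F s ∘ X) (ν s ∘ F s ∘ X) i j x)
      (-⟪hessian (F t ∘ X) (η ∘ F t ∘ X) i j x, ν t (F t (X x))⟫) t := by
    intro t ht i j
    have h3 := hasDerivAt_neg_inner_normal (a := fun i s => pd i (F s ∘ X) x)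
      (h2 t ht i j).2 (hli t ht) (ha t ht) (hNd t ht) (hNt t ht)
    refine (h3.congr_of_eventuallyEq ?_).congr_deriv ?_
    · filter_upwards [hJ.mem_nhds ht] with s hs
      exact secondForm_eq (hY2 s hs) (hNx s hs) ((hN s hs).mono fun y hy => hy.2) i j
    · unfold hessian
      simp_rw [christoffel_eq (hYd t ht) (hY2 t ht), hηpd t ht]
      rfl
  refine ⟨fun t ht => ⟨?_, ?_, hsec t ht⟩, fun c R hR hMR => ?_⟩
  · exact hasDerivAt_sqrt_det_gram (a := fun i s => pd i (F s ∘ X) x) (hli t ht) (ha t ht)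
  · exact hasDerivAt_inner_normal (a := fun i s => pd i (F s ∘ X) x) (hηd _)
      (hF.deriv t ht (X x)) (hli t ht) (ha t ht) (hNd t ht) (hNt t ht)
  · have hF0 : F 0 = id := funext hF.zero
    have hXd := hYd 0 h0
    have hX2 := hY2 0 h0
    have hN0 := hN 0 h0
    have hNx0 := hNx 0 h0
    have hli0 := hli 0 h0
    have hηpd0 := hηpd 0 h0
    have hsec0 := hsec 0 h0
    have hηX2 : ∀ j, DifferentiableAt ℝ (pd j (η ∘ X)) x := by
      intro j
      have h3 : ContDiffAt ℝ 2 (η ∘ X) x := hη.contDiffAt.comp x (hX.contDiffAt hx)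
      exact ((h3.fderiv_right (m := 1) (by norm_num)).differentiableAt one_ne_zero).clm_apply
        (differentiableAt_const _)
    rw [hF0] at hXd hX2 hN0 hNx0 hli0 hηpd0 hsec0
    simp only [Function.id_comp, id] at hXd hX2 hN0 hNx0 hli0 hηpd0 hsec0
    obtain ⟨κ, hκ, hNκ⟩ := exists_normal_eq_smul_of_sphere (c := c) hR hXd
      (hU.mono fun y hy => by
        have := hX.linearIndependent_flow hη1 hJ hJ' h0 hF h0 hy
        rwa [hF0] at this)
      (hU.mono fun y hy => by
        have := hX.mem hy
        rw [hMR] at this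
        exact mem_sphere_iff_norm.1 this) hNx0.continuousAt hN0
    have hu : ∀ i j, secondForm (F 0 ∘ X) (ν 0 ∘ F 0 ∘ X) i j x
        = κ * Matrix.gram ℝ (fun i => pd i (F 0 ∘ X) x) i j := by
      intro i j
      rw [hF0]
      simp only [Function.id_comp]
      have h3 : pd i (ν 0 ∘ X) x = κ • pd i X x := by
        rw [pd_congr hNκ]
        unfold pd
        rw [fderiv_fun_const_smul (hXd.self_of_nhds.sub_const c), fderiv_sub_const]
        rfl
      unfold secondForm
      rw [h3, real_inner_smul_left]
      rfl
    have h3 := hasDerivAt_trace_of_umbilic (a := fun i s => pd i (F s ∘ X) x) (hli 0 h0)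
      (ha 0 h0) (hsec 0 h0) hu
    refine h3.congr_deriv ?_
    have h4 := laplaceBeltrami_inner_normal (f := η ∘ X) hXd hX2 hli0
      (hXd.mono fun y hy => (hηd _).comp y hy) hηX2 hN0 hNκ
    simp only [Function.comp_apply] at h4
    rw [h4, hF0, hκ]
    simp only [Function.id_comp, id, hηpd0, metric_eq_gram, mul_neg, Finset.sum_neg_distrib]
    ring
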